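/- Let $(M,h)$ be a closed orientable Riemannian surface, that is, a compact connected orientable smooth $2$-manifold without boundary with a smooth Riemannian metric $h$. A graph in $M$ is the image of a nonempty abstract finite graph (a finite CW complex of dimension at most one; loops, multiple edges, isolated vertices and several components are allowed) under a topological embedding into $M$. Its length, $\operatorname{length}(\Gamma)\in[0,\infty]$, is its one-dimensional Hausdorff measure with respect to the Riemannian distance of $h$. A graph $\Gamma$ in $M$ captures the topology of $M$ if the map $i_*:H_1(\Gamma;\mathbb{R})\to H_1(M;\mathbb{R})$ induced by the inclusion $i:\Gamma\to M$ on singular homology is surjective. Put $$L(M,h):=\inf_{\Gamma}\operatorname{length}(\Gamma),$$ where the infimum is taken over all graphs $\Gamma$ in $M$ that capture its topology. Then $L(M,h)<\infty$, and there exists a graph $\Gamma$ in $M$ that captures the topology of $M$ and satisfies $\operatorname{length}(\Gamma)=L(M,h)$. -/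

import Mathlib

open scoped CategoryTheory Manifold ContDiff Bundle ENNReal

universe u

/-- A smooth surface `M` is orientable if it is covered by smooth charts all of whose transition
maps have positive Jacobian determinant. -/
def OrientableSurface (M : Type u) [TopologicalSpace M]
    [ChartedSpace (EuclideanSpace ℝ (Fin 2)) M] : Prop :=
  ∃ A : Set (OpenPartialHomeomorph M (EuclideanSpace ℝ (Fin 2))),
    A ⊆ IsManifold.maximalAtlas (𝓡 2) ∞ M ∧
    (∀ x : M, ∃ e ∈ A, x ∈ e.source) ∧
    ∀ e ∈ A, ∀ e' ∈ A, ∀ y ∈ (e.symm.trans e').source,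
      0 < (fderiv ℝ (e.symm.trans e') y).det

/-- `Γ` is a graph in `M`: a nonempty subset which, as a subspace of `M`, is a finite CW complex
without cells of dimension at least two. Such a CW complex is compact, so for Hausdorff `M`
these are exactly the images of (nonempty) abstract finite graphs, with loops and multiple edges
allowed, under topological embeddings into `M`. Neither connectedness nor the presence of an edge
is required. -/
def IsGraphIn {M : Type u} [TopologicalSpace M] (Γ : Set M) : Prop :=
  Γ.Nonempty ∧ ∃ C : Topology.CWComplex Γ,
    Topology.CWComplex.Finite Γ ∧ ∀ n : ℕ, 2 ≤ n → IsEmpty (C.cell n)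

/-- The first singular homology functor with real coefficients. -/
noncomputable def realH1 : TopCat.{u} ⥤ ModuleCat.{u} ℝ :=
  (AlgebraicTopology.singularHomologyFunctor.{u} (ModuleCat.{u} ℝ) 1).obj
    (ModuleCat.of ℝ (ULift.{u} ℝ))

/-- The inclusion of the subspace `Γ` in `M`, as a morphism of topological spaces. -/
def inclusionMap {M : Type u} [TopologicalSpace M] (Γ : Set M) :
    TopCat.of Γ ⟶ TopCat.of M :=
  TopCat.ofHom ⟨Subtype.val, continuous_subtype_val⟩

/-- `Γ` captures the topology of `M`: the map `H₁(Γ; ℝ) → H₁(M; ℝ)` induced by the inclusion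
is an epimorphism. -/
def CapturesTopology {M : Type u} [TopologicalSpace M] (Γ : Set M) : Prop :=
  Function.Surjective (realH1.map (inclusionMap Γ)).hom

/-- The length of a subset of a metric space: its one-dimensional Hausdorff measure. -/
noncomputable def graphLength {M : Type u} [EMetricSpace M] [MeasurableSpace M] [BorelSpace M]
    (Γ : Set M) : ℝ≥0∞ :=
  MeasureTheory.Measure.hausdorffMeasure 1 Γ

/-- `L(M)`: the infimum of the lengths of all graphs in `M` that capture its topology. -/
noncomputable def minGraphLength (M : Type u) [EMetricSpace M] [MeasurableSpace M]
    [BorelSpace M] : ℝ≥0∞ :=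
  ⨅ (Γ : Set M) (_ : IsGraphIn Γ ∧ CapturesTopology Γ), graphLength Γ

/-! The length minimisation is reduced to a finite-dimensional problem about systems of short edges,
where compactness applies. Over a field, surjectivity on `H₁` is dual to a statement about cochains
(`capturesTopology_iff`): a singular 1-cocycle on `M` with a primitive on `Γ` has one on all of `M`.
Cocycles have primitives on all balls of one uniform radius. Evaluating a cocycle along chosen
minimal segments therefore gives a function `Φ x y` of two points, additive at small scale
(`IsRipsCocycle`), and the capture condition can be expressed through these `Φ` for finite sets of
edges (`CapturesRips`). The two minimisation problems bound each other. Cutting a capturing graph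
into small pieces and keeping only the end points of each piece gives a capturing edge system that
is no longer (`exists_capturesRips_of_graph`). Conversely, edges are drawn as minimal segments
(`exists_graph_of_capturesRips`). Two segments may meet in infinitely many points, so each new one
is cut, at its first and last contact with each earlier arc, into subarcs having finite
intersections with the earlier arcs (`exists_subarcs`); the union is then a finite graph. A shortest
edge system exists because the number of vertices can be bounded (`CapturesRips.exists_card_le`). In
a system with the fewest edges no vertex is a leaf, a vertex of degree two has long incident edges,
and the cycle rank is bounded because a finite net detects all classes
(`card_le_of_minimal_capturesRips`). Systems with boundedly many vertices are parametrised by a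
compact product of copies of `M`, and capture survives small displacements
(`CapturesRips.of_dist_lt`), so the minimum is attained. -/

theorem LinearMap.exists_eq_comp_of_ker_le {V V' W : Type*} [AddCommGroup V] [Module ℝ V]
    [AddCommGroup V'] [Module ℝ V'] [AddCommGroup W] [Module ℝ W]
    (d : V →ₗ[ℝ] V') (c : V →ₗ[ℝ] W) (h : LinearMap.ker d ≤ LinearMap.ker c) :
    ∃ k : V' →ₗ[ℝ] W, c = k ∘ₗ d := by
  obtain ⟨s, hs⟩ := d.rangeRestrict.exists_rightInverse_of_surjective (LinearMap.range_rangeRestrict d)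
  obtain ⟨k, hk⟩ := LinearMap.exists_extend (c ∘ₗ s)
  refine ⟨k, LinearMap.ext fun x => ?_⟩
  have h1 : k (d x) = c (s (d.rangeRestrict x)) := LinearMap.congr_fun hk (d.rangeRestrict x)
  have h2 : d.rangeRestrict (s (d.rangeRestrict x)) = d.rangeRestrict x :=
    LinearMap.congr_fun hs (d.rangeRestrict x)
  have h3 : x - s (d.rangeRestrict x) ∈ LinearMap.ker d := by
    rw [LinearMap.mem_ker, map_sub, sub_eq_zero]
    exact (congrArg Subtype.val h2).symm
  have h4 := h h3
  rw [LinearMap.mem_ker, map_sub, sub_eq_zero] at h4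
  rw [LinearMap.comp_apply, h1, h4]

/-! ### Duality between surjectivity on homology and exactness of cocycles -/

section
open CategoryTheory

/-- A degree one homology map over `ℝ` is surjective if and only if every cocycle on the target
whose restriction to the source is a coboundary is itself a coboundary. -/
theorem surjective_homologyMap_one_iff (K L : ChainComplex (ModuleCat.{u} ℝ) ℕ) (φ : K ⟶ L) :
    Function.Surjective (HomologicalComplex.homologyMap φ 1).hom ↔
      ∀ c : L.X 1 ⟶ ModuleCat.of ℝ (ULift.{u} ℝ), L.d 2 1 ≫ c = 0 →
        (∃ h : K.X 0 ⟶ ModuleCat.of ℝ (ULift.{u} ℝ), φ.f 1 ≫ c = K.d 1 0 ≫ h) →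
        ∃ k : L.X 0 ⟶ ModuleCat.of ℝ (ULift.{u} ℝ), c = L.d 1 0 ≫ k := by
  -- A functional vanishing on cycles factors through the boundary map. An element `x` of the kernel
  -- is encoded as the morphism `t ↦ t • x`, so that it lifts to the cycles.
  have key : ∀ (N : ChainComplex (ModuleCat.{u} ℝ) ℕ) (c : N.X 1 ⟶ ModuleCat.of ℝ (ULift.{u} ℝ)),
      N.iCycles 1 ≫ c = 0 → ∃ k : N.X 0 ⟶ ModuleCat.of ℝ (ULift.{u} ℝ), c = N.d 1 0 ≫ k := by
    intro N c hc
    obtain ⟨k, hk⟩ := LinearMap.exists_eq_comp_of_ker_le (N.d 1 0).hom c.hom (by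
      intro x hx
      let ξ : ModuleCat.of ℝ (ULift.{u} ℝ) ⟶ N.X 1 := ModuleCat.ofHom
        (LinearMap.toSpanSingleton ℝ (N.X 1) x ∘ₗ ULift.moduleEquiv.toLinearMap)
      have hξ : ∀ t, ξ.hom t = t.down • x := fun t => rfl
      have hx' : ξ ≫ N.d 1 0 = 0 := by
        ext
        change (N.d 1 0).hom (ξ.hom _) = 0
        rw [hξ, map_smul, LinearMap.mem_ker.1 hx, smul_zero]
      have h2 : ξ ≫ c = 0 := by
        rw [← N.liftCycles_i ξ 0 (by simp) hx', Category.assoc, hc, Limits.comp_zero]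
      have h3 : c.hom (ξ.hom (ULift.up 1)) = 0 :=
        congrArg (fun g => g.hom (ULift.up 1)) h2
      rwa [hξ, one_smul] at h3)
    exact ⟨ModuleCat.ofHom k, ModuleCat.hom_ext hk⟩
  constructor
  · intro hs c hc ⟨h, hh⟩
    apply key
    have : Epi (HomologicalComplex.homologyMap φ 1) := (ModuleCat.epi_iff_surjective _).2 hs
    let g : L.homology 1 ⟶ ModuleCat.of ℝ (ULift.{u} ℝ) :=
      L.homologyι 1 ≫ L.descOpcycles c 2 (by simp) hc
    have hg : L.homologyπ 1 ≫ g = L.iCycles 1 ≫ c := by simp [g]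
    have : g = 0 := by
      rw [← cancel_epi (HomologicalComplex.homologyMap φ 1), ← cancel_epi (K.homologyπ 1),
        HomologicalComplex.homologyπ_naturality_assoc, hg,
        HomologicalComplex.cyclesMap_i_assoc, hh]
      simp
    rw [← hg, this, Limits.comp_zero]
  · intro H
    by_contra hs
    have hlt : LinearMap.range (HomologicalComplex.homologyMap φ 1).hom < ⊤ := by
      rw [lt_top_iff_ne_top]
      exact fun h => hs (LinearMap.range_eq_top.1 h)
    obtain ⟨g₀, hg₀, hle⟩ := Submodule.exists_le_ker_of_lt_top _ hlt
    -- A nonzero functional on homology that kills the image. Composing it with a linear retraction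
    -- onto the cycles turns it into a cocycle that is exact on `K` but not on `L`.
    let g : L.homology 1 ⟶ ModuleCat.of ℝ (ULift.{u} ℝ) :=
      ModuleCat.ofHom (ULift.moduleEquiv.symm.toLinearMap ∘ₗ g₀)
    have hg : HomologicalComplex.homologyMap φ 1 ≫ g = 0 := by
      ext x
      exact hle (LinearMap.mem_range_self _ x)
    have hi : Function.Injective (L.iCycles 1).hom := (ModuleCat.mono_iff_injective _).1 inferInstance
    obtain ⟨s, hs'⟩ := (L.iCycles 1).hom.exists_leftInverse_of_injective
      (LinearMap.ker_eq_bot.2 hi)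
    let c : L.X 1 ⟶ ModuleCat.of ℝ (ULift.{u} ℝ) :=
      ModuleCat.ofHom s ≫ L.homologyπ 1 ≫ g
    have hc : L.iCycles 1 ≫ c = L.homologyπ 1 ≫ g := by
      have : L.iCycles 1 ≫ ModuleCat.ofHom s = 𝟙 _ := by
        ext x; exact LinearMap.congr_fun hs' x
      simp only [c, ← Category.assoc, this, Category.id_comp]
    obtain ⟨k, hk⟩ := H c (by
        rw [← L.toCycles_i 2 1, Category.assoc, hc, ← Category.assoc]
        simp) (key K _ (by
        rw [← HomologicalComplex.cyclesMap_i_assoc, hc,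
          ← HomologicalComplex.homologyπ_naturality_assoc, hg, Limits.comp_zero]))
    have hz : g = 0 := by
      rw [← cancel_epi (L.homologyπ 1), ← hc, hk]
      simp
    apply hg₀
    ext x
    exact congrArg (fun g => (g.hom x).down) hz
end

/-! ### Cochains as functions on singular simplices -/

section
open CategoryTheory
open scoped Simplicial

/-- The real number by which a morphism `C_n(X; ℝ) ⟶ ℝ` multiplies on the summand of a simplex. -/
noncomputable def cochainValue {X : SSet.{u}} {n : ℕ}
    (c : (X.chainComplex (ModuleCat.of ℝ (ULift.{u} ℝ))).X n ⟶ ModuleCat.of ℝ (ULift.{u} ℝ))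
    (x : X _⦋n⦌) : ℝ :=
  ((X.ιChainComplex x ≫ c).hom (ULift.up 1)).down

theorem ulift_hom_ext {f g : ModuleCat.of ℝ (ULift.{u} ℝ) ⟶ ModuleCat.of ℝ (ULift.{u} ℝ)}
    (h : (f.hom (ULift.up 1)).down = (g.hom (ULift.up 1)).down) : f = g := by
  refine ModuleCat.hom_ext (LinearMap.ext fun t => ULift.down_injective ?_)
  have ht : t = t.down • ULift.up (1 : ℝ) := ULift.down_injective (by simp)
  rw [ht, map_smul, map_smul, ULift.smul_down, ULift.smul_down, h]

theorem cochainValue_injective {X : SSet.{u}} {n : ℕ}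
    {c c' : (X.chainComplex (ModuleCat.of ℝ (ULift.{u} ℝ))).X n ⟶ ModuleCat.of ℝ (ULift.{u} ℝ)}
    (h : cochainValue c = cochainValue c') : c = c' :=
  SSet.chainComplex_hom_ext fun x => ulift_hom_ext (congrFun h x)

theorem exists_cochainValue_eq {X : SSet.{u}} {n : ℕ} (a : X _⦋n⦌ → ℝ) :
    ∃ c : (X.chainComplex (ModuleCat.of ℝ (ULift.{u} ℝ))).X n ⟶ ModuleCat.of ℝ (ULift.{u} ℝ),
      cochainValue c = a := by
  refine ⟨Limits.Cofan.IsColimit.desc (X.isColimitChainComplexXCofan _ n)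
    (fun x => a x • 𝟙 (ModuleCat.of ℝ (ULift.{u} ℝ))), funext fun x => ?_⟩
  have := Limits.Cofan.IsColimit.fac (X.isColimitChainComplexXCofan
    (ModuleCat.of ℝ (ULift.{u} ℝ)) n) (fun x => a x • 𝟙 (ModuleCat.of ℝ (ULift.{u} ℝ))) x
  have h2 := congrArg (fun g => (g.hom (ULift.up (1 : ℝ))).down) this
  refine h2.trans ?_
  simp

theorem cochainValue_chainComplexMap_comp {X Y : SSet.{u}} (f : X ⟶ Y) {n : ℕ}
    (c : (Y.chainComplex (ModuleCat.of ℝ (ULift.{u} ℝ))).X n ⟶ ModuleCat.of ℝ (ULift.{u} ℝ))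
    (x : X _⦋n⦌) :
    cochainValue ((SSet.chainComplexMap f _).f n ≫ c) x = cochainValue c (f.app _ x) := by
  simp only [cochainValue, SSet.ι_chainComplexMap_f_assoc]

theorem cochainValue_d_comp {X : SSet.{u}} {n : ℕ}
    (c : (X.chainComplex (ModuleCat.of ℝ (ULift.{u} ℝ))).X n ⟶ ModuleCat.of ℝ (ULift.{u} ℝ))
    (x : X _⦋n + 1⦌) :
    cochainValue ((X.chainComplex _).d (n + 1) n ≫ c) x =
      ∑ i : Fin (n + 2), (-1) ^ i.val * cochainValue c (X.δ i x) := by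
  let ev : (ModuleCat.of ℝ (ULift.{u} ℝ) ⟶ ModuleCat.of ℝ (ULift.{u} ℝ)) →+ ℝ :=
    { toFun := fun g => (g.hom (ULift.up 1)).down
      map_zero' := rfl
      map_add' := fun _ _ => rfl }
  change ev _ = ∑ i : Fin (n + 2), (-1) ^ i.val * ev _
  simp only [SSet.ιChainComplex_d_assoc, Preadditive.sum_comp, Preadditive.zsmul_comp, map_sum,
    map_zsmul, zsmul_eq_mul]
  push_cast
  rfl

/-- The `i`-th face inclusion of standard simplices. -/
noncomputable def simplexFace {n : ℕ} (i : Fin (n + 2)) :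
    C(stdSimplex ℝ (Fin (n + 1)), stdSimplex ℝ (Fin (n + 2))) :=
  ⟨stdSimplex.map i.succAbove, stdSimplex.continuous_map _⟩

/-- A real singular `1`-cochain is a cocycle if it vanishes on boundaries of `2`-simplices. -/
def IsSingularCocycle {M : Type*} [TopologicalSpace M] (c : C(stdSimplex ℝ (Fin 2), M) → ℝ) :
    Prop :=
  ∀ σ : C(stdSimplex ℝ (Fin 3), M),
    c (σ.comp (simplexFace 0)) - c (σ.comp (simplexFace 1)) + c (σ.comp (simplexFace 2)) = 0

/-- On singular `1`-simplices contained in `U`, the cochain `c` is the coboundary of `f`. -/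
def IsPotentialOn {M : Type*} [TopologicalSpace M] (c : C(stdSimplex ℝ (Fin 2), M) → ℝ)
    (f : M → ℝ) (U : Set M) : Prop :=
  ∀ σ : C(stdSimplex ℝ (Fin 2), M), (∀ t, σ t ∈ U) →
    c σ = f (σ (stdSimplex.vertex 1)) - f (σ (stdSimplex.vertex 0))

theorem map_succAbove_fin_one (i : Fin 2) (t : stdSimplex ℝ (Fin 1)) :
    stdSimplex.map i.succAbove t = stdSimplex.vertex (i.succAbove 0) := by
  rw [Subsingleton.elim t (stdSimplex.vertex 0), stdSimplex.map_vertex]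

theorem isCocycle_iff_isSingularCocycle {X : Type u} [TopologicalSpace X]
    (c : ((TopCat.toSSet.obj (TopCat.of X)).chainComplex (ModuleCat.of ℝ (ULift.{u} ℝ))).X 1 ⟶
      ModuleCat.of ℝ (ULift.{u} ℝ)) (a : C(stdSimplex ℝ (Fin 2), X) → ℝ)
    (hca : cochainValue c = fun x => a (TopCat.toSSetObjEquiv (TopCat.of X) (.op ⦋1⦌) x)) :
    ((TopCat.toSSet.obj (TopCat.of X)).chainComplex _).d 2 1 ≫ c = 0 ↔ IsSingularCocycle a := by
  have key : ∀ x, cochainValue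
      (((TopCat.toSSet.obj (TopCat.of X)).chainComplex _).d 2 1 ≫ c) x =
      a ((TopCat.toSSetObjEquiv (TopCat.of X) (.op ⦋2⦌) x).comp (simplexFace 0)) -
      a ((TopCat.toSSetObjEquiv (TopCat.of X) (.op ⦋2⦌) x).comp (simplexFace 1)) +
      a ((TopCat.toSSetObjEquiv (TopCat.of X) (.op ⦋2⦌) x).comp (simplexFace 2)) := by
    intro x
    rw [cochainValue_d_comp, hca, Fin.sum_univ_three]
    have h : ∀ i, TopCat.toSSetObjEquiv (TopCat.of X) (.op ⦋1⦌)
      ((TopCat.toSSet.obj (TopCat.of X)).δ i x) =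
        (TopCat.toSSetObjEquiv (TopCat.of X) (.op ⦋2⦌) x).comp (simplexFace i) := fun _ => rfl
    simp only [h]
    norm_num
    ring
  have hzero : ∀ x : (TopCat.toSSet.obj (TopCat.of X)) _⦋2⦌, cochainValue
      (0 : ((TopCat.toSSet.obj (TopCat.of X)).chainComplex (ModuleCat.of ℝ (ULift.{u} ℝ))).X 2 ⟶
        ModuleCat.of ℝ (ULift.{u} ℝ)) x = 0 := by
    intro x
    simp only [cochainValue, Limits.comp_zero]
    rfl
  constructor
  · intro h σ
    have := key ((TopCat.toSSetObjEquiv (TopCat.of X) (.op ⦋2⦌)).symm σ)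
    rw [h, hzero, Equiv.apply_symm_apply] at this
    exact this.symm
  · intro h
    refine cochainValue_injective (funext fun x => ?_)
    rw [key, hzero]
    exact h _

theorem exists_eq_d_comp_iff_exists_isPotentialOn {X : Type u} [TopologicalSpace X]
    (c : ((TopCat.toSSet.obj (TopCat.of X)).chainComplex (ModuleCat.of ℝ (ULift.{u} ℝ))).X 1 ⟶
      ModuleCat.of ℝ (ULift.{u} ℝ)) (a : C(stdSimplex ℝ (Fin 2), X) → ℝ)
    (hca : cochainValue c = fun x => a (TopCat.toSSetObjEquiv (TopCat.of X) (.op ⦋1⦌) x)) :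
    (∃ k : ((TopCat.toSSet.obj (TopCat.of X)).chainComplex (ModuleCat.of ℝ (ULift.{u} ℝ))).X 0 ⟶
      ModuleCat.of ℝ (ULift.{u} ℝ),
      c = ((TopCat.toSSet.obj (TopCat.of X)).chainComplex _).d 1 0 ≫ k) ↔
      ∃ f, IsPotentialOn a f Set.univ := by
  let e := fun y : X => (TopCat.toSSetObjEquiv (TopCat.of X) (.op ⦋0⦌)).symm
    (ContinuousMap.const _ y)
  have he : ∀ (x : (TopCat.toSSet.obj (TopCat.of X)) _⦋1⦌) (i j : Fin 2), i.succAbove 0 = j →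
      (TopCat.toSSet.obj (TopCat.of X)).δ i x =
        e (TopCat.toSSetObjEquiv (TopCat.of X) (.op ⦋1⦌) x (stdSimplex.vertex j)) := by
    intro x i j hij
    rw [Equiv.eq_symm_apply]
    ext t
    change TopCat.toSSetObjEquiv (TopCat.of X) (.op ⦋1⦌) x
      (stdSimplex.map (X := Fin 1) (Y := Fin 2) i.succAbove t) =
      TopCat.toSSetObjEquiv (TopCat.of X) (.op ⦋1⦌) x (stdSimplex.vertex j)
    rw [map_succAbove_fin_one, hij]
  have key : ∀ k : ((TopCat.toSSet.obj (TopCat.of X)).chainComplex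
      (ModuleCat.of ℝ (ULift.{u} ℝ))).X 0 ⟶ ModuleCat.of ℝ (ULift.{u} ℝ), ∀ x,
      cochainValue (((TopCat.toSSet.obj (TopCat.of X)).chainComplex _).d 1 0 ≫ k) x =
        cochainValue k
          (e (TopCat.toSSetObjEquiv (TopCat.of X) (.op ⦋1⦌) x (stdSimplex.vertex 1))) -
        cochainValue k
          (e (TopCat.toSSetObjEquiv (TopCat.of X) (.op ⦋1⦌) x (stdSimplex.vertex 0))) := by
    intro k x
    rw [cochainValue_d_comp, Fin.sum_univ_two, he x 0 1 rfl, he x 1 0 rfl]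
    norm_num
    ring
  constructor
  · rintro ⟨k, hk⟩
    refine ⟨fun y => cochainValue k (e y), fun σ _ => ?_⟩
    have := congrFun hca ((TopCat.toSSetObjEquiv (TopCat.of X) (.op ⦋1⦌)).symm σ)
    rw [hk, key, Equiv.apply_symm_apply] at this
    exact this.symm
  · rintro ⟨f, hf⟩
    obtain ⟨k, hk⟩ := exists_cochainValue_eq (X := TopCat.toSSet.obj (TopCat.of X)) (n := 0)
      (fun x => f (TopCat.toSSetObjEquiv (TopCat.of X) (.op ⦋0⦌) x (stdSimplex.vertex 0)))
    have hke : ∀ y, cochainValue k (e y) = f y := by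
      intro y
      rw [hk]
      simp only [e, Equiv.apply_symm_apply, ContinuousMap.const_apply]
    refine ⟨k, cochainValue_injective (funext fun x => ?_)⟩
    rw [key, hke, hke, hca]
    exact hf _ fun _ => trivial

/-- A subset captures the topology if and only if every real singular cocycle which is exact on
the subset is exact. -/
theorem capturesTopology_iff {M : Type u} [TopologicalSpace M] (Γ : Set M) :
    CapturesTopology Γ ↔ ∀ c : C(stdSimplex ℝ (Fin 2), M) → ℝ, IsSingularCocycle c →
      (∃ f, IsPotentialOn c f Γ) → ∃ f, IsPotentialOn c f Set.univ := by
  have H : CapturesTopology Γ ↔ Function.Surjective (HomologicalComplex.homologyMap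
    (SSet.chainComplexMap (TopCat.toSSet.map (inclusionMap Γ))
      (ModuleCat.of ℝ (ULift.{u} ℝ))) 1).hom := Iff.rfl
  have hres : ∀ a : C(stdSimplex ℝ (Fin 2), M) → ℝ, (∃ f, IsPotentialOn a f Γ) ↔
      ∃ f, IsPotentialOn (fun σ : C(stdSimplex ℝ (Fin 2), Γ) =>
        a (ContinuousMap.comp ⟨Subtype.val, continuous_subtype_val⟩ σ)) f Set.univ := by
    classical
    intro a
    constructor
    · rintro ⟨f, hf⟩
      exact ⟨fun y => f y, fun σ _ => hf _ fun t => (σ t).2⟩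
    · rintro ⟨f, hf⟩
      -- The value 0 off `Γ` is irrelevant: only simplices inside `Γ` are tested.
      refine ⟨fun y => if hy : y ∈ Γ then f ⟨y, hy⟩ else 0, fun σ hσ => ?_⟩
      have := hf ⟨fun t => ⟨σ t, hσ t⟩, by fun_prop⟩ fun _ => trivial
      simp only [dif_pos (hσ _)]
      exact this
  have hpull : ∀ (c : ((TopCat.toSSet.obj (TopCat.of M)).chainComplex
      (ModuleCat.of ℝ (ULift.{u} ℝ))).X 1 ⟶ ModuleCat.of ℝ (ULift.{u} ℝ))
      (a : C(stdSimplex ℝ (Fin 2), M) → ℝ), (cochainValue c = fun x =>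
      a (TopCat.toSSetObjEquiv (TopCat.of M) (.op ⦋1⦌) x)) →
      cochainValue ((SSet.chainComplexMap (TopCat.toSSet.map (inclusionMap Γ))
        (ModuleCat.of ℝ (ULift.{u} ℝ))).f 1 ≫ c) = fun x =>
      (fun σ : C(stdSimplex ℝ (Fin 2), Γ) =>
        a (ContinuousMap.comp ⟨Subtype.val, continuous_subtype_val⟩ σ))
          (TopCat.toSSetObjEquiv (TopCat.of Γ) (.op ⦋1⦌) x) := by
    intro c a hca
    funext x
    rw [cochainValue_chainComplexMap_comp, hca]
    rfl
  rw [H, surjective_homologyMap_one_iff]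
  constructor
  · intro h a ha hΓ
    obtain ⟨c, hc⟩ := exists_cochainValue_eq (X := TopCat.toSSet.obj (TopCat.of M)) (n := 1)
      (fun x => a (TopCat.toSSetObjEquiv (TopCat.of M) (.op ⦋1⦌) x))
    rw [← exists_eq_d_comp_iff_exists_isPotentialOn c a hc]
    apply h c ((isCocycle_iff_isSingularCocycle c a hc).2 ha)
    exact (exists_eq_d_comp_iff_exists_isPotentialOn _ _ (hpull c a hc)).2 ((hres a).1 hΓ)
  · intro h c hc hΓ
    let a : C(stdSimplex ℝ (Fin 2), M) → ℝ := fun σ =>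
      cochainValue c ((TopCat.toSSetObjEquiv (TopCat.of M) (.op ⦋1⦌)).symm σ)
    have hca : cochainValue c = fun x =>
        a (TopCat.toSSetObjEquiv (TopCat.of M) (.op ⦋1⦌) x) := by
      funext x
      simp only [a, Equiv.symm_apply_apply]
    rw [exists_eq_d_comp_iff_exists_isPotentialOn c a hca]
    apply h a ((isCocycle_iff_isSingularCocycle c a hca).1 hc)
    exact (hres a).2 ((exists_eq_d_comp_iff_exists_isPotentialOn _ _ (hpull c a hca)).1 hΓ)
end

/-! ### Cocycles along paths and local primitives -/

open Set Filter Topology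

section
variable {V : Type*} [AddCommGroup V] [Module ℝ V] [TopologicalSpace V] [ContinuousAdd V]
  [ContinuousSMul ℝ V] {M : Type*} [TopologicalSpace M]

/-- The affine singular simplex with prescribed vertices. -/
noncomputable def affineSimplex {n : ℕ} (p : Fin (n + 1) → V) :
    C(stdSimplex ℝ (Fin (n + 1)), V) :=
  ⟨fun t => ∑ i, t.1 i • p i, continuous_finsetSum _ fun i _ =>
    ((continuous_apply i).comp continuous_subtype_val).smul continuous_const⟩

theorem affineSimplex_comp_simplexFace {n : ℕ} (p : Fin (n + 2) → V) (i : Fin (n + 2)) :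
    (affineSimplex p).comp (simplexFace i) = affineSimplex (p ∘ i.succAbove) := by
  ext t
  change ∑ j, (stdSimplex.map i.succAbove t) j • p j = ∑ j, t j • p (i.succAbove j)
  rw [stdSimplex.map_coe, ← Finset.sum_fiberwise Finset.univ i.succAbove]
  refine Finset.sum_congr rfl fun j _ => ?_
  rw [FunOnFinite.linearMap_apply_apply, Finset.sum_smul]
  refine Finset.sum_congr rfl fun k hk => ?_
  rw [(Finset.mem_filter.1 hk).2]

theorem affineSimplex_two_apply (p q : V) (t : stdSimplex ℝ (Fin 2)) :
    affineSimplex ![p, q] t = t.1 0 • p + t.1 1 • q := by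
  simp [affineSimplex, Fin.sum_univ_two]

/-- The value of a `1`-cochain on the image of the affine segment from `p` to `q` under `g`. -/
noncomputable def lineValue (c : C(stdSimplex ℝ (Fin 2), M) → ℝ) (g : C(V, M)) (p q : V) : ℝ :=
  c (g.comp (affineSimplex ![p, q]))

/-- The cocycle identity for the image under `g` of the affine triangle `p, q, s`. -/
theorem IsSingularCocycle.lineValue_add {c : C(stdSimplex ℝ (Fin 2), M) → ℝ}
    (hc : IsSingularCocycle c) (g : C(V, M)) (p q s : V) :
    lineValue c g p q + lineValue c g q s = lineValue c g p s := by
  have h := hc (g.comp (affineSimplex ![p, q, s]))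
  simp only [ContinuousMap.comp_assoc, affineSimplex_comp_simplexFace] at h
  have h0 : (![p, q, s] : Fin 3 → V) ∘ Fin.succAbove 0 = ![q, s] := by
    ext i; fin_cases i <;> rfl
  have h1 : (![p, q, s] : Fin 3 → V) ∘ Fin.succAbove 1 = ![p, s] := by
    ext i; fin_cases i <;> rfl
  have h2 : (![p, q, s] : Fin 3 → V) ∘ Fin.succAbove 2 = ![p, q] := by
    ext i; fin_cases i <;> rfl
  rw [h0, h1, h2] at h
  simp only [lineValue]
  linarith

theorem IsSingularCocycle.lineValue_self {c : C(stdSimplex ℝ (Fin 2), M) → ℝ}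
    (hc : IsSingularCocycle c) (g : C(V, M)) (p : V) : lineValue c g p p = 0 := by
  have := hc.lineValue_add g p p p
  linarith

theorem IsPotentialOn.lineValue_eq {c : C(stdSimplex ℝ (Fin 2), M) → ℝ} {f : M → ℝ} {U : Set M}
    (hf : IsPotentialOn c f U) (g : C(V, M)) (p q : V) (h : ∀ x ∈ segment ℝ p q, g x ∈ U) :
    lineValue c g p q = f (g q) - f (g p) := by
  rw [lineValue, hf]
  · simp [affineSimplex_two_apply]
  · intro t
    refine h _ ⟨t.1 0, t.1 1, t.2.1 0, t.2.1 1, ?_, ?_⟩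
    · simpa [Fin.sum_univ_two] using t.2.2
    · simp [affineSimplex_two_apply]
end

/-- The point of the standard `1`-simplex with parameter the projection of `s` to `[0, 1]`. -/
noncomputable def simplexOfReal : C(ℝ, stdSimplex ℝ (Fin 2)) :=
  ⟨fun s => stdSimplexHomeomorphUnitInterval.symm (projIcc 0 1 zero_le_one s), by fun_prop⟩

theorem simplexOfReal_zero : simplexOfReal 0 = stdSimplex.vertex 0 := by
  change stdSimplexHomeomorphUnitInterval.symm (projIcc 0 1 zero_le_one 0) = _
  rw [projIcc_left, Homeomorph.symm_apply_eq]
  exact stdSimplexHomeomorphUnitInterval_zero.symm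

theorem simplexOfReal_one : simplexOfReal 1 = stdSimplex.vertex 1 := by
  change stdSimplexHomeomorphUnitInterval.symm (projIcc 0 1 zero_le_one 1) = _
  rw [projIcc_right, Homeomorph.symm_apply_eq]
  exact stdSimplexHomeomorphUnitInterval_one.symm

theorem comp_simplexOfReal_line {M : Type*} [TopologicalSpace M] (σ : C(stdSimplex ℝ (Fin 2), M)) :
    (σ.comp simplexOfReal).comp (affineSimplex ![(0 : ℝ), 1]) = σ := by
  ext t
  simp only [ContinuousMap.comp_apply]
  congr 1
  change stdSimplexHomeomorphUnitInterval.symm (projIcc 0 1 zero_le_one _) = t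
  have h1 : affineSimplex ![(0 : ℝ), 1] t = t.1 1 := by simp [affineSimplex_two_apply]
  rw [h1, Homeomorph.symm_apply_eq]
  exact projIcc_of_mem zero_le_one ⟨stdSimplex.zero_le t 1, stdSimplex.le_one t 1⟩

/-- A global primitive is a function that is locally a primitive. -/
theorem isPotentialOn_of_local {M : Type*} [TopologicalSpace M]
    {c : C(stdSimplex ℝ (Fin 2), M) → ℝ} (hc : IsSingularCocycle c) {f : M → ℝ} {Γ : Set M}
    (h : ∀ x ∈ Γ, ∃ U ∈ 𝓝 x, IsPotentialOn c f (U ∩ Γ)) : IsPotentialOn c f Γ := by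
  intro σ hσ
  set g := σ.comp simplexOfReal with hg
  have hgΓ : ∀ t, g t ∈ Γ := fun t => hσ _
  -- The value of `c` along the path up to time `t` and `f (g t)` have the same local increments, so
  -- their difference is constant; it is then compared at 0 and 1.
  have hloc : IsLocallyConstant fun t : ℝ => lineValue c g 0 t - f (g t) := by
    rw [IsLocallyConstant.iff_eventually_eq]
    intro t
    obtain ⟨U, hU, hfU⟩ := h (g t) (hgΓ t)
    obtain ⟨ε, hε, hball⟩ := Metric.mem_nhds_iff.1 (g.continuous.continuousAt hU)
    filter_upwards [Metric.ball_mem_nhds t hε] with s hs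
    have h1 := hfU.lineValue_eq g t s fun x hx => ⟨hball
      ((convex_ball t ε).segment_subset (Metric.mem_ball_self hε) hs hx), hgΓ x⟩
    have h2 := hc.lineValue_add g 0 t s
    linarith
  have h01 := hloc.apply_eq_of_isPreconnected isPreconnected_univ (mem_univ (1 : ℝ)) (mem_univ 0)
  have e1 : lineValue c g 0 1 = c σ := by rw [lineValue, hg, comp_simplexOfReal_line]
  have e0 := hc.lineValue_self g (0 : ℝ)
  have p1 : g 1 = σ (stdSimplex.vertex 1) := by rw [hg, ContinuousMap.comp_apply, simplexOfReal_one]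
  have p0 : g 0 = σ (stdSimplex.vertex 0) := by rw [hg, ContinuousMap.comp_apply, simplexOfReal_zero]
  simp only [e1, e0, p1, p0] at h01
  linarith

/-- A cocycle has a primitive on every set that is parametrized by part of a convex set. -/
theorem IsSingularCocycle.exists_isPotentialOn_of_convex {M E : Type*} [TopologicalSpace M]
    [AddCommGroup E] [Module ℝ E] [TopologicalSpace E] [IsTopologicalAddGroup E]
    [ContinuousSMul ℝ E] {c : C(stdSimplex ℝ (Fin 2), M) → ℝ} (hc : IsSingularCocycle c)
    {S : Set E} (hS : Convex ℝ S) {o : E} (ho : o ∈ S) {ψ : E → M} (hψ : ContinuousOn ψ S)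
    {U : Set M} {φ : M → E} (hφ : ContinuousOn φ U) (hφS : MapsTo φ U S)
    (hψφ : ∀ y ∈ U, ψ (φ y) = y) : ∃ f, IsPotentialOn c f U := by
  classical
  have hmem : ∀ (s : ℝ) {y : M}, y ∈ U → o + (projIcc (0 : ℝ) 1 zero_le_one s : ℝ) • (φ y - o) ∈ S :=
    fun s y hy => hS.add_smul_sub_mem ho (hφS hy) (projIcc (0 : ℝ) 1 zero_le_one s).2
  have hcl : Continuous fun s : ℝ => (projIcc (0 : ℝ) 1 zero_le_one s : ℝ) :=
    continuous_subtype_val.comp continuous_projIcc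
  let rad : ∀ y ∈ U, C(ℝ, M) := fun y hy =>
    ⟨fun s => ψ (o + (projIcc (0 : ℝ) 1 zero_le_one s : ℝ) • (φ y - o)),
      hψ.comp_continuous (continuous_const.add (hcl.smul continuous_const)) fun s => hmem s hy⟩
  -- Poincaré lemma: the primitive at `y` is the value of `c` on the image under `ψ` of the straight
  -- path from `o` to `φ y`.
  refine ⟨fun y => if hy : y ∈ U then lineValue c (rad y hy) 0 1 else 0, fun σ hσ => ?_⟩
  have hφσ : Continuous fun t : ℝ => φ (σ (simplexOfReal t)) :=
    hφ.comp_continuous (σ.comp simplexOfReal).continuous fun t => hσ _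
  -- The square swept out by the radial paths to the points of `σ`. One side is constant, the
  -- opposite one is `σ`, and the remaining two are the radial paths to its end points; the diagonal
  -- splits it into two triangles.
  let g : C(ℝ × ℝ, M) :=
    ⟨fun p => ψ (o + (projIcc (0 : ℝ) 1 zero_le_one p.1 : ℝ) • (φ (σ (simplexOfReal p.2)) - o)),
      hψ.comp_continuous (continuous_const.add ((hcl.comp continuous_fst).smul
        ((hφσ.comp continuous_snd).sub continuous_const))) fun p => hmem p.1 (hσ _)⟩
  have hside : ∀ (i : Fin 2) (r : ℝ), simplexOfReal r = stdSimplex.vertex i →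
      lineValue c g (0, r) (1, r) = lineValue c (rad _ (hσ (stdSimplex.vertex i))) 0 1 := by
    intro i r hr
    rw [lineValue, lineValue]
    congr 1
    ext t
    have h01 : t.1 0 + t.1 1 = 1 := stdSimplex.add_eq_one t
    have ht : t.1 0 * r + t.1 1 * r = r := by rw [← add_mul, h01, one_mul]
    simp [g, rad, affineSimplex_two_apply, ht, hr]
  have hbot : lineValue c g (0, 0) (0, 1) = 0 := by
    refine Eq.trans ?_ (hc.lineValue_self g (0, 0))
    rw [lineValue, lineValue]
    congr 1
    ext t
    simp [g, affineSimplex_two_apply]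
  have htop : lineValue c g (1, 0) (1, 1) = c σ := by
    rw [lineValue]
    congr 1
    conv_rhs => rw [← comp_simplexOfReal_line σ]
    ext t
    have ht : t.1 0 + t.1 1 = 1 := stdSimplex.add_eq_one t
    simp [g, affineSimplex_two_apply, ht, hψφ _ (hσ _)]
  have e1 := hc.lineValue_add g (0, 0) (1, 0) (1, 1)
  have e2 := hc.lineValue_add g (0, 0) (0, 1) (1, 1)
  rw [hside 0 0 simplexOfReal_zero, htop] at e1
  rw [hside 1 1 simplexOfReal_one, hbot] at e2
  simp only [dif_pos (hσ _)]
  linarith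

/-- Every point of a manifold has a neighbourhood on which all cocycles are exact. -/
theorem exists_open_forall_isPotentialOn {M E : Type*} [NormedAddCommGroup E] [NormedSpace ℝ E]
    [TopologicalSpace M] [ChartedSpace E M] (x : M) :
    ∃ U : Set M, IsOpen U ∧ x ∈ U ∧ ∀ c : C(stdSimplex ℝ (Fin 2), M) → ℝ, IsSingularCocycle c →
      ∃ f, IsPotentialOn c f U := by
  obtain ⟨ρ, hρ, hball⟩ := Metric.isOpen_iff.1 (chartAt E x).open_target _ (mem_chart_target E x)
  refine ⟨(chartAt E x).source ∩ chartAt E x ⁻¹' Metric.ball (chartAt E x x) ρ,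
    (chartAt E x).isOpen_inter_preimage Metric.isOpen_ball,
    ⟨mem_chart_source E x, Metric.mem_ball_self hρ⟩, fun c hc => ?_⟩
  exact hc.exists_isPotentialOn_of_convex (convex_ball (chartAt E x x) ρ)
    (Metric.mem_ball_self hρ) ((chartAt E x).continuousOn_symm.mono hball)
    ((chartAt E x).continuousOn.mono inter_subset_left) (fun y hy => hy.2)
    fun y hy => (chartAt E x).left_inv hy.1

/-- On a compact manifold there is a uniform radius of balls on which all cocycles are exact. -/
theorem exists_radius_forall_isPotentialOn (M E : Type*) [NormedAddCommGroup E] [NormedSpace ℝ E]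
    [PseudoMetricSpace M] [CompactSpace M] [ChartedSpace E M] :
    ∃ r > 0, ∀ c : C(stdSimplex ℝ (Fin 2), M) → ℝ, IsSingularCocycle c →
      ∀ x : M, ∃ f, IsPotentialOn c f (Metric.ball x r) := by
  choose U hUo hxU hU using exists_open_forall_isPotentialOn (M := M) (E := E)
  obtain ⟨r, hr, h⟩ := lebesgue_number_lemma_of_metric (isCompact_univ (X := M)) hUo
    fun x _ => mem_iUnion.2 ⟨x, hxU x⟩
  refine ⟨r, hr, fun c hc x => ?_⟩
  obtain ⟨i, hi⟩ := h x (mem_univ x)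
  obtain ⟨f, hf⟩ := hU i c hc
  exact ⟨f, fun σ hσ => hf σ fun t => hi (hσ t)⟩

/-! ### Midpoints and minimal segments -/

/-- In a Riemannian manifold, points at finite distance have approximate midpoints. -/
theorem exists_approx_midpoint {E H M : Type*} [NormedAddCommGroup E] [NormedSpace ℝ E]
    [TopologicalSpace H] {I : ModelWithCorners ℝ E H} [EMetricSpace M] [ChartedSpace H M]
    [Bundle.RiemannianBundle (fun x : M => TangentSpace I x)] [IsRiemannianManifold I M]
    (x y : M) (hxy : edist x y ≠ ⊤) {ε : ℝ≥0∞} (hε : ε ≠ 0) :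
    ∃ m : M, edist x m = edist x y / 2 ∧ edist m y ≤ edist x y / 2 + ε := by
  have hlt : Manifold.riemannianEDist I x y < edist x y + ε := by
    rw [← IsRiemannianManifold.out (I := I) x y]
    exact ENNReal.lt_add_right hxy hε
  obtain ⟨γ, h0, h1, hγ, hlen⟩ := Manifold.exists_lt_of_riemannianEDist_lt hlt
  have hcont : ContinuousOn (fun t => edist x (γ t)) (Icc 0 1) :=
    (continuous_const.edist continuous_id).comp_continuousOn hγ.continuousOn
  have hmem : edist x y / 2 ∈ Icc (edist x (γ 0)) (edist x (γ 1)) := by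
    rw [h0, h1, edist_self]
    exact ⟨zero_le, ENNReal.half_le_self⟩
  -- Take the point of an almost shortest path at distance exactly half from `x`. The path up to
  -- there already has at least that length, so little more than half remains.
  obtain ⟨t, ht, htm⟩ := intermediate_value_Icc zero_le_one hcont hmem
  refine ⟨γ t, htm, ?_⟩
  have hle0 : edist x (γ t) ≤ Manifold.pathELength I γ 0 t := by
    rw [IsRiemannianManifold.out (I := I) x (γ t)]
    exact Manifold.riemannianEDist_le_pathELength (hγ.mono (Icc_subset_Icc le_rfl ht.2)) h0 rfl ht.1
  have hle1 : edist (γ t) y ≤ Manifold.pathELength I γ t 1 := by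
    rw [IsRiemannianManifold.out (I := I) (γ t) y]
    exact Manifold.riemannianEDist_le_pathELength (hγ.mono (Icc_subset_Icc ht.1 le_rfl)) rfl h1 ht.2
  have hsum := Manifold.pathELength_add (I := I) (γ := γ) ht.1 ht.2
  have hhalf : edist x y / 2 ≠ ⊤ := ENNReal.div_ne_top hxy two_ne_zero
  have key : edist x y / 2 + edist (γ t) y ≤ edist x y / 2 + (edist x y / 2 + ε) := by
    rw [← add_assoc, ENNReal.add_halves]
    calc edist x y / 2 + edist (γ t) y = edist x (γ t) + edist (γ t) y := by rw [← htm]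
      _ ≤ Manifold.pathELength I γ 0 t + Manifold.pathELength I γ t 1 := add_le_add hle0 hle1
      _ = Manifold.pathELength I γ 0 1 := hsum
      _ ≤ edist x y + ε := hlen.le
  exact (ENNReal.add_le_add_iff_left hhalf).1 key

/-- In a connected extended metric space all distances are finite. -/
theorem edist_ne_top_of_preconnected {M : Type*} [EMetricSpace M] [PreconnectedSpace M] (x y : M) :
    edist x y ≠ ⊤ := by
  have hloc : IsLocallyConstant fun z : M => edist x z = ⊤ := by
    rw [IsLocallyConstant.iff_eventually_eq]
    intro z
    filter_upwards [Metric.eball_mem_nhds z one_pos] with w hw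
    have hw' : edist w z < 1 := hw
    have hwz : edist w z ≠ ⊤ := hw'.ne_top
    refine propext ⟨fun h => ?_, fun h => ?_⟩
    · by_contra hz
      exact ((edist_triangle x z w).trans_lt (ENNReal.add_lt_top.2
        ⟨lt_top_iff_ne_top.2 hz, by rwa [edist_comm, lt_top_iff_ne_top]⟩)).ne h
    · by_contra hz
      exact ((edist_triangle x w z).trans_lt (ENNReal.add_lt_top.2
        ⟨lt_top_iff_ne_top.2 hz, lt_top_iff_ne_top.2 hwz⟩)).ne h
  intro h
  have := hloc.apply_eq_of_preconnectedSpace x y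
  rw [edist_self] at this
  exact ENNReal.zero_ne_top (this.mpr h)

section
variable {M : Type*} [MetricSpace M] [CompactSpace M]

/-- By compactness the larger of the two distances attains its minimum, which is at most half of
`dist x y`; the triangle inequality then forces both to be equal to it. -/
theorem exists_midpoint_of_approx
    (h : ∀ x y : M, ∀ ε > 0, ∃ m, dist x m ≤ dist x y / 2 + ε ∧ dist m y ≤ dist x y / 2 + ε)
    (x y : M) : ∃ m, dist x m = dist x y / 2 ∧ dist m y = dist x y / 2 := by
  obtain ⟨m, -, hm⟩ := isCompact_univ.exists_isMinOn (s := (univ : Set M)) ⟨x, mem_univ x⟩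
    (f := fun m => max (dist x m) (dist m y)) (by fun_prop)
  have hle : max (dist x m) (dist m y) ≤ dist x y / 2 := by
    refine le_of_forall_pos_le_add fun ε hε => ?_
    obtain ⟨m', h1, h2⟩ := h x y ε hε
    exact (hm (mem_univ m')).trans (max_le h1 h2)
  have h1 := (le_max_left _ _).trans hle
  have h2 := (le_max_right _ _).trans hle
  have h3 := dist_triangle x m y
  exact ⟨m, by linarith, by linarith⟩

/-- In a compact metric space with midpoints, any two points are joined by a segment. -/
theorem exists_segment (h : ∀ x y : M, ∃ m, dist x m = dist x y / 2 ∧ dist m y = dist x y / 2)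
    (x y : M) : ∃ γ : ℝ → M, γ 0 = x ∧ γ (dist x y) = y ∧
      ∀ s ∈ Icc 0 (dist x y), ∀ t ∈ Icc 0 (dist x y), dist (γ s) (γ t) = |s - t| := by
  -- Sets containing both end points on which `dist x` is an isometry into `[0, dist x y]`. A
  -- maximal one will be the whole segment.
  let 𝒮 : Set (Set M) := {S | x ∈ S ∧ y ∈ S ∧
    ∀ u ∈ S, dist x u ≤ dist x y ∧ ∀ v ∈ S, dist u v = |dist x u - dist x v|}
  have h𝒮 : ({x, y} : Set M) ∈ 𝒮 := by
    refine ⟨by simp, by simp, fun u hu => ⟨?_, fun v hv => ?_⟩⟩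
    · rcases hu with rfl | rfl <;> simp
    · rcases hu with rfl | rfl <;> rcases hv with rfl | rfl <;> simp [dist_comm]
  obtain ⟨S, hxyS, hmax⟩ := zorn_subset_nonempty 𝒮 (by
    intro c hc hchain hne
    refine ⟨⋃₀ c, ⟨?_, ?_, ?_⟩, fun s hs => subset_sUnion_of_mem hs⟩
    · obtain ⟨s, hs⟩ := hne
      exact ⟨s, hs, (hc hs).1⟩
    · obtain ⟨s, hs⟩ := hne
      exact ⟨s, hs, (hc hs).2.1⟩
    · rintro u ⟨s, hs, hus⟩
      refine ⟨((hc hs).2.2 u hus).1, ?_⟩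
      rintro v ⟨t, ht, hvt⟩
      rcases hchain.total hs ht with hst | hst
      · exact ((hc ht).2.2 u (hst hus)).2 v hvt
      · exact ((hc hs).2.2 u hus).2 v (hst hvt)) {x, y} h𝒮
  obtain ⟨hxS, hyS, hS⟩ := hmax.prop
  have hclosed : IsClosed S := by
    have hcl : closure S ∈ 𝒮 := by
      refine ⟨subset_closure hxS, subset_closure hyS, fun u hu => ⟨?_, fun v hv => ?_⟩⟩
      · exact closure_minimal (fun u hu => (hS u hu).1)
          (isClosed_le (continuous_const.dist continuous_id) continuous_const) hu
      · have h1 : ∀ u ∈ S, ∀ v ∈ closure S, dist u v = |dist x u - dist x v| := fun u hu v hv =>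
          closure_minimal (fun v hv => (hS u hu).2 v hv)
            (isClosed_eq (by fun_prop) (by fun_prop)) hv
        exact closure_minimal (s := S) (t := {u | dist u v = |dist x u - dist x v|})
          (fun u hu => h1 u hu v hv) (isClosed_eq (by fun_prop) (by fun_prop)) hu
    exact isClosed_of_closure_subset (hmax.le_of_ge hcl subset_closure)
  have hA : IsCompact (dist x '' S) := hclosed.isCompact.image (by fun_prop)
  -- A missing value `t` lies in a gap whose ends are values at points `u` and `v` of `S`. Their
  -- midpoint can be added to `S`, contradicting maximality.
  have hsurj : ∀ t ∈ Icc 0 (dist x y), ∃ u ∈ S, dist x u = t := by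
    intro t ht
    by_contra hcon
    push Not at hcon
    obtain ⟨a, ⟨⟨u, hu, rfl⟩, hat⟩, ha⟩ := (hA.inter_right isClosed_Iic).exists_isGreatest
      ⟨0, ⟨x, hxS, dist_self x⟩, ht.1⟩
    obtain ⟨b, ⟨⟨v, hv, rfl⟩, hbt⟩, hb⟩ := (hA.inter_right isClosed_Ici).exists_isLeast
      ⟨dist x y, ⟨y, hyS, rfl⟩, ht.2⟩
    have hat' : dist x u < t := lt_of_le_of_ne hat (hcon u hu)
    have hbt' : t < dist x v := lt_of_le_of_ne hbt (hcon v hv).symm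
    have huv : dist u v = dist x v - dist x u := by
      rw [(hS u hu).2 v hv, abs_sub_comm, abs_of_pos (by linarith)]
    obtain ⟨m, hm1, hm2⟩ := h u v
    have hxm : dist x m = (dist x u + dist x v) / 2 := by
      have h1 := dist_triangle x u m
      have h2 := dist_triangle x m v
      linarith
    have hwm : ∀ w ∈ S, dist w m = |dist x w - dist x m| := by
      intro w hw
      refine le_antisymm ?_ ?_
      · rcases le_total (dist x w) t with hwt | hwt
        · have hwu : dist x w ≤ dist x u := ha ⟨⟨w, hw, rfl⟩, hwt⟩
          have h1 := (hS w hw).2 u hu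
          rw [abs_sub_comm, abs_of_nonneg (by linarith)] at h1
          rw [abs_sub_comm, abs_of_nonneg (by linarith)]
          have := dist_triangle w u m
          linarith
        · have hwu : dist x v ≤ dist x w := hb ⟨⟨w, hw, rfl⟩, hwt⟩
          have h1 := (hS w hw).2 v hv
          rw [abs_of_nonneg (by linarith)] at h1
          rw [abs_of_nonneg (by linarith)]
          have := dist_triangle w v m
          rw [dist_comm v m] at this
          linarith
      · rw [abs_sub_comm, abs_sub_le_iff]
        have h1 := dist_triangle x w m
        have h2 := dist_triangle x m w
        rw [dist_comm m w] at h2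
        constructor <;> linarith
    have hins : insert m S ∈ 𝒮 := by
      refine ⟨Or.inr hxS, Or.inr hyS, ?_⟩
      rintro w (rfl | hw)
      · refine ⟨?_, ?_⟩
        · have := (hS v hv).1
          linarith
        · rintro v' (rfl | hv')
          · simp
          · rw [dist_comm, hwm v' hv', abs_sub_comm]
      · refine ⟨(hS w hw).1, ?_⟩
        rintro v' (rfl | hv')
        · exact hwm w hw
        · exact (hS w hw).2 v' hv'
    have hmS : m ∈ S := hmax.le_of_ge hins (subset_insert m S) (mem_insert m S)
    rcases le_total (dist x m) t with hmt | hmt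
    · have : dist x m ≤ dist x u := ha ⟨⟨m, hmS, rfl⟩, hmt⟩
      linarith
    · have : dist x v ≤ dist x m := hb ⟨⟨m, hmS, rfl⟩, hmt⟩
      linarith
  have : Nonempty M := ⟨x⟩
  choose! γ hγS hγ using hsurj
  have h0 : (0 : ℝ) ∈ Icc 0 (dist x y) := ⟨le_rfl, dist_nonneg⟩
  have h1 : dist x y ∈ Icc 0 (dist x y) := ⟨dist_nonneg, le_rfl⟩
  refine ⟨γ, ?_, ?_, fun s hs t ht => ?_⟩
  · exact (dist_eq_zero.1 (hγ 0 h0)).symm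
  · rw [← dist_eq_zero, (hS _ (hγS _ h1)).2 y hyS, hγ _ h1, sub_self, abs_zero]
  · rw [(hS _ (hγS s hs)).2 _ (hγS t ht), hγ s hs, hγ t ht]
end

/-! ### Edge systems and cocycles at a fixed scale -/

section
variable {M : Type*} [MetricSpace M]

/-- A function of two points satisfying the cocycle relation at scale `r`. -/
def IsRipsCocycle (r : ℝ) (Φ : M → M → ℝ) : Prop :=
  ∀ x y z, dist x y < r → dist x z < r → Φ y z = Φ x z - Φ x y

/-- A function of two points that is a coboundary at scale `s`. -/
def IsRipsTrivial (s : ℝ) (Φ : M → M → ℝ) : Prop :=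
  ∃ f : M → ℝ, ∀ x y, dist x y < s → Φ x y = f y - f x

/-- A system of edges between points captures `Z` if every member of `Z` which is a coboundary on
the edges is a coboundary at scale `s`. -/
def CapturesRips {V : Type*} (Z : Submodule ℝ (M → M → ℝ)) (s : ℝ) (x : V → M)
    (e : Finset (V × V)) : Prop :=
  ∀ Φ ∈ Z, (∃ f : V → ℝ, ∀ p ∈ e, Φ (x p.1) (x p.2) = f p.2 - f p.1) → IsRipsTrivial s Φ

/-- The total length of a system of edges. -/
noncomputable def edgeSum {V : Type*} (x : V → M) (e : Finset (V × V)) : ℝ :=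
  ∑ p ∈ e, dist (x p.1) (x p.2)

theorem IsRipsCocycle.self {r : ℝ} (hr : 0 < r) {Φ : M → M → ℝ} (h : IsRipsCocycle r Φ) (x : M) :
    Φ x x = 0 := by
  have := h x x x (by simpa) (by simpa)
  linarith

theorem IsRipsCocycle.symm {r : ℝ} (hr : 0 < r) {Φ : M → M → ℝ} (h : IsRipsCocycle r Φ) {x y : M}
    (hxy : dist x y < r) : Φ y x = -Φ x y := by
  have := h x y x hxy (by simpa)
  rw [h.self hr] at this
  linarith

/-- A primitive `k` on the net extends by `k (n y) + Φ (n y) y`, where `n y` is a net point near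
`y`. For `dist y y' < s` the net points are less than `2 * δ + s` apart, whence the scale. -/
theorem IsRipsCocycle.trivial_of_net {r s δ : ℝ} {Φ : M → M → ℝ}
    (h : IsRipsCocycle r Φ) (hδ : 0 < δ) (hs : 0 < s) (hr : 2 * δ + s ≤ r) {N : Set M}
    (hN : ∀ y, ∃ p ∈ N, dist p y < δ) {k : M → ℝ}
    (hk : ∀ p ∈ N, ∀ q ∈ N, dist p q < 2 * δ + s → Φ p q = k q - k p) : IsRipsTrivial s Φ := by
  choose n hn hnd using hN
  refine ⟨fun y => k (n y) + Φ (n y) y, fun y y' hyy' => ?_⟩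
  have h1 := dist_triangle (n y) y y'
  have h2 := dist_triangle (n y) y' (n y')
  have h3 := hnd y
  have h4 := hnd y'
  have h5 := dist_comm (n y') y'
  have e1 := h (n y) y y' (by linarith) (by linarith)
  have e2 := h (n y') (n y) y' (by rw [dist_comm]; linarith) (by linarith)
  have e3 := hk (n y') (hn y') (n y) (hn y) (by rw [dist_comm]; linarith)
  simp only
  linarith

/-- A system of edges none of which is superfluous has bounded first Betti number. -/
theorem card_le_of_minimal_capturesRips {r s ε δ : ℝ} (Z : Submodule ℝ (M → M → ℝ))
    (hZ : ∀ Φ ∈ Z, IsRipsCocycle r Φ) (hδ : 0 < δ) (hε : 0 < ε) (hr : 2 * δ + 2 * ε ≤ r)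
    {N : Finset M} (hN : ∀ y, ∃ p ∈ N, dist p y < δ) {E : Finset (M × M)}
    (hEε : ∀ p ∈ E, dist p.1 p.2 ≤ ε) (hE : CapturesRips Z s id E)
    (hmin : ∀ E', E' ⊂ E → ¬ CapturesRips Z s id E') {V : Finset M}
    (hV : ∀ p ∈ E, p.1 ∈ V ∧ p.2 ∈ V) : E.card ≤ V.card + N.card * N.card := by
  classical
  -- `D` is the coboundary of the graph, so its cokernel is the first cohomology of the graph. `R`
  -- restricts cocycles to edges and `ev` to pairs of net points.
  let D : (V → ℝ) →ₗ[ℝ] (E → ℝ) :=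
    LinearMap.pi fun p => (LinearMap.proj (⟨p.1.2, (hV p.1 p.2).2⟩ : V) : (V → ℝ) →ₗ[ℝ] ℝ) -
      LinearMap.proj (⟨p.1.1, (hV p.1 p.2).1⟩ : V)
  let R : Z →ₗ[ℝ] (E → ℝ) :=
    LinearMap.pi fun p => LinearMap.proj p.1.2 ∘ₗ LinearMap.proj p.1.1 ∘ₗ Z.subtype
  let ev : Z →ₗ[ℝ] (N × N → ℝ) :=
    LinearMap.pi fun p => LinearMap.proj p.2.1 ∘ₗ LinearMap.proj p.1.1 ∘ₗ Z.subtype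
  have hD : ∀ (f : M → ℝ) (p : E), D (fun v => f v) p = f p.1.2 - f p.1.1 := fun f p => rfl
  have hR : ∀ (Φ : Z) (p : E), R Φ p = Φ.1 p.1.1 p.1.2 := fun Φ p => rfl
  let q := (LinearMap.range D).mkQ
  have hsurj : Function.Surjective (q ∘ₗ R) := by
    rw [← LinearMap.range_eq_top, LinearMap.range_comp, Submodule.map_mkQ_eq_top,
      Submodule.eq_top_iff']
    -- Deleting `p` destroys capture, so some nontrivial `Φ` has a potential `f` on the other edges.
    -- The defect of `f` on `p` is nonzero because `E` captures; thus `Φ` minus the coboundary of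
    -- `f` is a nonzero multiple of the indicator of `p`.
    have hsingle : ∀ p : E, Pi.single p 1 ∈ LinearMap.range D ⊔ LinearMap.range R := by
      intro p
      have hp := hmin _ (Finset.erase_ssubset p.2)
      unfold CapturesRips at hp
      push Not at hp
      obtain ⟨Φ, hΦ, ⟨f, hf⟩, hnt⟩ := hp
      have hκ : Φ p.1.1 p.1.2 - (f p.1.2 - f p.1.1) ≠ 0 := by
        intro h0
        refine hnt (hE Φ hΦ ⟨f, fun p' hp' => ?_⟩)
        by_cases hpp : p' = p.1
        · rw [hpp]
          simp only [id]
          linarith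
        · exact hf p' (Finset.mem_erase.2 ⟨hpp, hp'⟩)
      have hψ : R ⟨Φ, hΦ⟩ - D (fun v => f v) =
          (Φ p.1.1 p.1.2 - (f p.1.2 - f p.1.1)) • Pi.single p 1 := by
        ext p'
        rw [Pi.sub_apply, hR, hD, Pi.smul_apply]
        by_cases hpp : p' = p
        · subst hpp
          simp
        · rw [Pi.single_eq_of_ne hpp, smul_zero, sub_eq_zero]
          exact hf p'.1 (Finset.mem_erase.2 ⟨fun h => hpp (Subtype.ext h), p'.2⟩)
      have hmem : (Φ p.1.1 p.1.2 - (f p.1.2 - f p.1.1)) • (Pi.single p 1 : E → ℝ) ∈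
          LinearMap.range D ⊔ LinearMap.range R := by
        rw [← hψ]
        exact Submodule.sub_mem _ (Submodule.mem_sup_right (LinearMap.mem_range_self _ _))
          (Submodule.mem_sup_left (LinearMap.mem_range_self _ _))
      exact (Submodule.smul_mem_iff _ hκ).1 hmem
    intro g
    rw [← Finset.univ_sum_single g]
    refine Submodule.sum_mem _ fun p _ => ?_
    have : Pi.single p (g p) = g p • (Pi.single p 1 : E → ℝ) := by
      rw [← Pi.single_smul, smul_eq_mul, mul_one]
    rw [this]
    exact Submodule.smul_mem _ _ (hsingle p)
  -- If `Φ` vanishes on net pairs, the zero primitive on the net extends, so `Φ` is a coboundary at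
  -- scale `2 * ε`, hence on all edges. The cokernel of `D` is therefore a quotient of the range of
  -- `ev`, of dimension at most `N.card * N.card`.
  have hker : LinearMap.ker ev ≤ LinearMap.ker (q ∘ₗ R) := by
    intro Φ hΦ
    have hz : ∀ p ∈ (N : Set M), ∀ p' ∈ (N : Set M), dist p p' < 2 * δ + 2 * ε →
        Φ.1 p p' = (fun _ => (0 : ℝ)) p' - (fun _ => (0 : ℝ)) p := by
      intro p hp p' hp' _
      have : Φ.1 p p' = 0 := congrFun (LinearMap.mem_ker.1 hΦ) (⟨p, hp⟩, ⟨p', hp'⟩)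
      rw [this, sub_self]
    obtain ⟨f, hf⟩ := (hZ Φ.1 Φ.2).trivial_of_net hδ (by linarith) hr hN hz
    rw [LinearMap.mem_ker, LinearMap.comp_apply, Submodule.mkQ_apply, Submodule.Quotient.mk_eq_zero]
    refine ⟨fun v => f v, funext fun p => ?_⟩
    rw [hD, hR, hf]
    linarith [hEε p.1 p.2]
  obtain ⟨k, hk⟩ := LinearMap.exists_eq_comp_of_ker_le ev (q ∘ₗ R) hker
  have hksurj : Function.Surjective k := by
    intro y
    obtain ⟨x, hx⟩ := hsurj y
    exact ⟨ev x, by rw [← hx, hk]; rfl⟩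
  have h1 := LinearMap.finrank_le_finrank_of_surjective hksurj
  have h2 := (LinearMap.range D).finrank_quotient_add_finrank
  have h3 := LinearMap.finrank_range_le D
  simp only [Module.finrank_fintype_fun_eq_card, Fintype.card_prod, Fintype.card_coe] at h1 h2 h3
  omega

/-- The endpoint of the edge `p` opposite to `v`. -/
noncomputable def otherEnd (v : M) (p : M × M) : M :=
  open Classical in if p.1 = v then p.2 else p.1

theorem dist_otherEnd {v : M} {p : M × M} (h : p.1 = v ∨ p.2 = v) :
    dist v (otherEnd v p) = dist p.1 p.2 := by
  unfold otherEnd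
  split_ifs with h1
  · rw [h1]
  · rw [← h.resolve_left h1, dist_comm]

/-- If all neighbours of `v` are among `x` and `z`, the edge `(x, z)` can replace the edges at `v`,
and none is needed when `x = z`. A potential on the new system is redefined at `v` as `f x + Φ x v`,
and the triangle `x, v, z` gives the right increment towards `z`. -/
theorem CapturesRips.remove_vertex [DecidableEq M] {r s : ℝ} {Z : Submodule ℝ (M → M → ℝ)}
    (hr : 0 < r) (hZ : ∀ Φ ∈ Z, IsRipsCocycle r Φ) {E : Finset (M × M)} {v x z : M}
    (hvx : dist v x < r) (hvz : dist v z < r) (hxz : dist x z < r)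
    (hxz' : ∀ p ∈ E, (p.1 = v ∨ p.2 = v) → otherEnd v p = x ∨ otherEnd v p = z)
    (hE : CapturesRips Z s id E) {E' : Finset (M × M)}
    (hE' : ∀ p ∈ E, ¬ (p.1 = v ∨ p.2 = v) → p ∈ E') (hxzE : x ≠ z → (x, z) ∈ E') :
    CapturesRips Z s id E' := by
  intro Φ hΦ ⟨f, hf⟩
  have hR := hZ Φ hΦ
  have hfxz : Φ x z = f z - f x := by
    by_cases h : x = z
    · rw [h, hR.self hr, sub_self]
    · exact hf _ (hxzE h)
  have hvx' : dist x v < r := by rwa [dist_comm]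
  set f' := Function.update f v (f x + Φ x v) with hf'
  have hx : Φ v x = f' x - f' v := by
    rw [hf', Function.update_self]
    by_cases h : x = v
    · rw [h, Function.update_self, hR.self hr]
      ring
    · rw [Function.update_of_ne h, hR.symm hr hvx']
      ring
  have hz : Φ v z = f' z - f' v := by
    by_cases h : z = v
    · rw [h, hR.self hr, sub_self]
    · rw [hf', Function.update_self, Function.update_of_ne h]
      have := hR x v z hvx' hxz
      linarith
  refine hE Φ hΦ ⟨f', fun p hp => ?_⟩
  by_cases hinc : p.1 = v ∨ p.2 = v
  · have hw : Φ v (otherEnd v p) = f' (otherEnd v p) - f' v := by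
      rcases hxz' p hp hinc with h | h <;> rw [h] <;> assumption
    have hd : dist v (otherEnd v p) < r := by
      rcases hxz' p hp hinc with h | h <;> rw [h] <;> assumption
    have hs := hR.symm hr hd
    unfold otherEnd at hw hs
    split_ifs at hw hs with h1
    · simpa [h1] using hw
    · simp only [id, hinc.resolve_left h1]
      linarith
  · have h1 : p.1 ≠ v := fun h => hinc (Or.inl h)
    have h2 : p.2 ≠ v := fun h => hinc (Or.inr h)
    rw [hf', Function.update_of_ne h1, Function.update_of_ne h2]
    exact hf p (hE' p hp hinc)

/-- Every capturing system of edges can be replaced by a capturing system of no greater length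
with boundedly many vertices. -/
theorem CapturesRips.exists_card_le {r s ε δ : ℝ} {Z : Submodule ℝ (M → M → ℝ)}
    (hZ : ∀ Φ ∈ Z, IsRipsCocycle r Φ) (hδ : 0 < δ) (hε : 0 < ε) (hr : 2 * δ + 2 * ε ≤ r)
    {N : Finset M} (hN : ∀ y, ∃ p ∈ N, dist p y < δ) {E₀ : Finset (M × M)}
    (hE₀ε : ∀ p ∈ E₀, dist p.1 p.2 ≤ ε) (hE₀ : CapturesRips Z s id E₀) :
    ∃ (E : Finset (M × M)) (V : Finset M), CapturesRips Z s id E ∧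
      (∀ p ∈ E, dist p.1 p.2 ≤ ε) ∧ edgeSum id E ≤ edgeSum id E₀ ∧
      (∀ p ∈ E, p.1 ∈ V ∧ p.2 ∈ V) ∧
      (V.card : ℝ) ≤ 2 * (N.card * N.card) + 2 * edgeSum id E₀ / ε := by
  classical
  have hr0 : 0 < r := by linarith
  let P : Finset (M × M) → Prop := fun E => CapturesRips Z s id E ∧
    (∀ p ∈ E, dist p.1 p.2 ≤ ε) ∧ edgeSum id E ≤ edgeSum id E₀
  -- The number of edges is minimised, not the length; competitors only have to be no longer than
  -- `E₀`.
  obtain ⟨E, ⟨hE, hEε, hEsum⟩, hmin⟩ := exists_minimalFor_of_wellFoundedLT P Finset.card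
    ⟨E₀, hE₀, hE₀ε, le_rfl⟩
  replace hmin : ∀ E', P E' → E.card ≤ E'.card := fun E' h =>
    (le_total E.card E'.card).elim id (fun h' => hmin h h')
  let V := E.image Prod.fst ∪ E.image Prod.snd
  have hV : ∀ p ∈ E, p.1 ∈ V ∧ p.2 ∈ V := fun p hp =>
    ⟨Finset.mem_union_left _ (Finset.mem_image_of_mem _ hp),
      Finset.mem_union_right _ (Finset.mem_image_of_mem _ hp)⟩
  refine ⟨E, V, hE, hEε, hEsum, hV, ?_⟩
  have hsub : ∀ E', E' ⊆ E → (∀ p ∈ E', dist p.1 p.2 ≤ ε) ∧ edgeSum id E' ≤ edgeSum id E₀ :=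
    fun E' h => ⟨fun p hp => hEε p (h hp),
      (Finset.sum_le_sum_of_subset_of_nonneg h fun _ _ _ => dist_nonneg).trans hEsum⟩
  have hcard : E.card ≤ V.card + N.card * N.card :=
    card_le_of_minimal_capturesRips Z hZ hδ hε hr hN hEε hE (fun E' hE' hcap =>
      (Finset.card_lt_card hE').not_ge (hmin E' ⟨hcap, hsub E' hE'.1⟩)) hV
  let I : M → Finset (M × M) := fun v => E.filter fun p => p.1 = v ∨ p.2 = v
  let J : M → Finset (M × M) := fun v => E.filter fun p => ¬ (p.1 = v ∨ p.2 = v)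
  have hIJ : ∀ v, (I v).card + (J v).card = E.card := fun v =>
    Finset.card_filter_add_card_filter_not _
  have hlen : ∀ v, ∀ p ∈ I v, dist v (otherEnd v p) = dist p.1 p.2 ∧ dist p.1 p.2 ≤ ε :=
    fun v p hp => ⟨dist_otherEnd (Finset.mem_filter.1 hp).2, hEε p (Finset.mem_filter.1 hp).1⟩
  -- A vertex with a single incident edge could be deleted together with that edge.
  have hI1 : ∀ v ∈ V, 2 ≤ (I v).card := by
    intro v hv
    by_contra hlt
    have hpos : 0 < (I v).card := by
      rw [Finset.card_pos]
      rcases Finset.mem_union.1 hv with h | h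
      · obtain ⟨p, hp, rfl⟩ := Finset.mem_image.1 h
        exact ⟨p, Finset.mem_filter.2 ⟨hp, Or.inl rfl⟩⟩
      · obtain ⟨p, hp, rfl⟩ := Finset.mem_image.1 h
        exact ⟨p, Finset.mem_filter.2 ⟨hp, Or.inr rfl⟩⟩
    obtain ⟨p, hp⟩ := Finset.card_eq_one.1 (show (I v).card = 1 by omega)
    have hpI : p ∈ I v := by rw [hp]; exact Finset.mem_singleton_self p
    have hd := hlen v p hpI
    have hcap : CapturesRips Z s id (J v) := by
      refine hE.remove_vertex hr0 hZ (v := v) (x := otherEnd v p) (z := otherEnd v p)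
        (by linarith) (by linarith) (by simpa) (fun p' hp' hinc => ?_)
        (fun p' hp' hinc => Finset.mem_filter.2 ⟨hp', hinc⟩) (fun h => absurd rfl h)
      have : p' ∈ I v := Finset.mem_filter.2 ⟨hp', hinc⟩
      rw [hp, Finset.mem_singleton] at this
      rw [this]
      exact Or.inl rfl
    have := hmin (J v) ⟨hcap, hsub _ (Finset.filter_subset _ _)⟩
    have := hIJ v
    omega
  -- Two edges of total length below `ε` could be replaced by the chord between their other ends,
  -- which is admissible and not longer.
  have hI2 : ∀ v ∈ V, (I v).card = 2 → ε ≤ ∑ p ∈ I v, dist p.1 p.2 := by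
    intro v hv h2
    by_contra! hlt
    obtain ⟨p, q, hpq, hp⟩ := Finset.card_eq_two.1 h2
    have hpI : p ∈ I v := by rw [hp]; simp
    have hqI : q ∈ I v := by rw [hp]; simp
    have hdp := hlen v p hpI
    have hdq := hlen v q hqI
    have htri := dist_triangle_left (otherEnd v p) (otherEnd v q) v
    have hsumI : ∑ p ∈ I v, dist p.1 p.2 = dist p.1 p.2 + dist q.1 q.2 := by
      rw [hp, Finset.sum_pair hpq]
    have hcap : CapturesRips Z s id (insert (otherEnd v p, otherEnd v q) (J v)) := by
      refine hE.remove_vertex hr0 hZ (v := v) (x := otherEnd v p) (z := otherEnd v q)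
        (by linarith) (by linarith) (by linarith) (fun p' hp' hinc => ?_)
        (fun p' hp' hinc => Finset.mem_insert_of_mem (Finset.mem_filter.2 ⟨hp', hinc⟩))
        (fun _ => Finset.mem_insert_self _ _)
      have : p' ∈ I v := Finset.mem_filter.2 ⟨hp', hinc⟩
      rw [hp, Finset.mem_insert, Finset.mem_singleton] at this
      rcases this with h | h <;> simp [h]
    have hsplit : ∑ p ∈ I v, dist p.1 p.2 + ∑ p ∈ J v, dist p.1 p.2 = edgeSum id E :=
      Finset.sum_filter_add_sum_filter_not _ _ _
    have hins : edgeSum id (insert (otherEnd v p, otherEnd v q) (J v)) ≤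
        dist (otherEnd v p) (otherEnd v q) + ∑ p ∈ J v, dist p.1 p.2 := by
      by_cases h : (otherEnd v p, otherEnd v q) ∈ J v
      · rw [Finset.insert_eq_of_mem h]
        exact le_add_of_nonneg_left dist_nonneg
      · exact (Finset.sum_insert h).le
    have := hmin _ ⟨hcap, fun p' hp' => by
      rcases Finset.mem_insert.1 hp' with rfl | h
      · simp only
        linarith
      · exact hEε p' (Finset.mem_filter.1 h).1, by linarith⟩
    have h3 := Finset.card_insert_le (otherEnd v p, otherEnd v q) (J v)
    have := hIJ v
    omega
  -- Handshake count, only an inequality because a loop is incident to its vertex once.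
  have hcount : ∀ w : M × M → ℝ, (∀ p, 0 ≤ w p) →
      ∑ v ∈ V, ∑ p ∈ I v, w p ≤ 2 * ∑ p ∈ E, w p := by
    intro w hw
    have h1 : ∀ v, ∑ p ∈ I v, w p = ∑ p ∈ E, if p.1 = v ∨ p.2 = v then w p else 0 := fun v =>
      Finset.sum_filter _ _
    simp only [h1]
    rw [Finset.sum_comm, Finset.mul_sum]
    refine Finset.sum_le_sum fun p hp => ?_
    calc ∑ v ∈ V, (if p.1 = v ∨ p.2 = v then w p else 0)
        ≤ ∑ v ∈ V, ((if p.1 = v then w p else 0) + if p.2 = v then w p else 0) := by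
          refine Finset.sum_le_sum fun v _ => ?_
          have := hw p
          by_cases ha : p.1 = v <;> by_cases hb : p.2 = v <;> simp [ha, hb, this]
      _ = 2 * w p := by
          rw [Finset.sum_add_distrib, Finset.sum_ite_eq, Finset.sum_ite_eq, if_pos (hV p hp).1,
            if_pos (hV p hp).2]
          ring
  have hdeg := hcount (fun _ => 1) fun _ => zero_le_one
  have hlensum := hcount (fun p => dist p.1 p.2) fun _ => dist_nonneg
  simp only [Finset.sum_const, nsmul_eq_mul, mul_one] at hdeg
  have hv : ∀ v ∈ V, (3 : ℝ) ≤ (I v).card + (∑ p ∈ I v, dist p.1 p.2) / ε := by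
    intro v hv
    have h0 : 0 ≤ (∑ p ∈ I v, dist p.1 p.2) / ε :=
      div_nonneg (Finset.sum_nonneg fun _ _ => dist_nonneg) hε.le
    rcases (hI1 v hv).eq_or_lt with h2 | h3
    · have := (one_le_div hε).2 (hI2 v hv h2.symm)
      rw [← h2]
      push_cast
      linarith
    · have : (3 : ℝ) ≤ (I v).card := by exact_mod_cast h3
      linarith
  have hsum := Finset.sum_le_sum hv
  rw [Finset.sum_const, nsmul_eq_mul, Finset.sum_add_distrib, ← Finset.sum_div] at hsum
  have hfin : (∑ v ∈ V, ∑ p ∈ I v, dist p.1 p.2) / ε ≤ 2 * edgeSum id E₀ / ε := by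
    refine div_le_div_of_nonneg_right (hlensum.trans ?_) hε.le
    exact mul_le_mul_of_nonneg_left hEsum zero_le_two
  -- Summing `hv` gives `3 |V| ≤ 2 |E| + 2 L / ε`, where `L` is the length of `E₀`; with `|E| ≤ |V|
  -- + |N|²` this leaves `|V| ≤ 2 |N|² + 2 L / ε`.
  have hcard' : (E.card : ℝ) ≤ V.card + N.card * N.card := by exact_mod_cast hcard
  linarith

/-- A potential `f` for the positions `x` becomes one for the nearby positions `y` after adding `Φ
(x i) (y i)`. Hence limits of capturing configurations capture, which gives closedness in the
compactness argument. -/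
theorem CapturesRips.of_dist_lt {V : Type*} {r s ε : ℝ} {Z : Submodule ℝ (M → M → ℝ)}
    (hZ : ∀ Φ ∈ Z, IsRipsCocycle r Φ) (hε : 0 < ε) (hr : 2 * ε < r) {x y : V → M}
    {e : Finset (V × V)} (hy : CapturesRips Z s y e)
    (hx : ∀ p ∈ e, dist (x p.1) (x p.2) ≤ ε) (hxy : ∀ i, dist (x i) (y i) < ε) :
    CapturesRips Z s x e := by
  intro Φ hΦ ⟨f, hf⟩
  have hr0 : 0 < r := by linarith
  refine hy Φ hΦ ⟨fun i => f i + Φ (x i) (y i), fun p hp => ?_⟩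
  have h1 := hx p hp
  have h2 := hxy p.1
  have h3 := hxy p.2
  have h4 := dist_triangle (x p.1) (x p.2) (y p.2)
  have e1 := hZ Φ hΦ (x p.1) (y p.1) (y p.2) (by linarith) (by linarith)
  have e2 := hZ Φ hΦ (x p.2) (x p.1) (y p.2) (by rw [dist_comm]; linarith) (by linarith)
  have e3 := (hZ Φ hΦ).symm hr0 (show dist (x p.1) (x p.2) < r by linarith)
  have e4 := hf p hp
  simp only
  linarith

theorem CapturesRips.exists_fin [Nonempty M] {s : ℝ} {Z : Submodule ℝ (M → M → ℝ)}
    {E : Finset (M × M)} (hE : CapturesRips Z s id E) {V : Finset M}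
    (hV : ∀ p ∈ E, p.1 ∈ V ∧ p.2 ∈ V) {K : ℕ} (hK : V.card < K) :
    ∃ (x : Fin K → M) (e : Finset (Fin K × Fin K)), CapturesRips Z s x e ∧
      (∀ q ∈ e, ∃ p ∈ E, x q.1 = p.1 ∧ x q.2 = p.2) ∧ edgeSum x e = edgeSum id E := by
  classical
  have : NeZero K := ⟨by omega⟩
  obtain ⟨x, hx⟩ : ∃ x : Fin K → M, ∀ v ∈ V, ∃ k, x k = v := by
    refine ⟨fun k => if h : k.1 < V.card then V.equivFin.symm ⟨k, h⟩ else Classical.arbitrary M,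
      fun v hv => ⟨⟨V.equivFin ⟨v, hv⟩, (V.equivFin ⟨v, hv⟩).2.trans hK⟩, ?_⟩⟩
    simp
  choose! j hj using hx
  refine ⟨x, E.image fun p => (j p.1, j p.2), fun Φ hΦ ⟨f, hf⟩ => ?_, fun q hq => ?_, ?_⟩
  · refine hE Φ hΦ ⟨f ∘ j, fun p hp => ?_⟩
    have := hf _ (Finset.mem_image_of_mem _ hp)
    simp only [hj _ (hV p hp).1, hj _ (hV p hp).2] at this
    exact this
  · obtain ⟨p, hp, rfl⟩ := Finset.mem_image.1 hq
    exact ⟨p, hp, hj _ (hV p hp).1, hj _ (hV p hp).2⟩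
  · rw [edgeSum, Finset.sum_image]
    · refine Finset.sum_congr rfl fun p hp => ?_
      simp only [hj _ (hV p hp).1, hj _ (hV p hp).2, id]
    · intro p hp q hq hpq
      have h1 := congrArg (fun t => x t.1) hpq
      have h2 := congrArg (fun t => x t.2) hpq
      simp only [hj _ (hV p hp).1, hj _ (hV p hp).2, hj _ (hV q hq).1, hj _ (hV q hq).2] at h1 h2
      exact Prod.ext h1 h2

/-- Among the capturing systems of short edges there is one of minimal length. -/
theorem CapturesRips.exists_minimal [CompactSpace M] [Nonempty M] {r s ε δ : ℝ}
    {Z : Submodule ℝ (M → M → ℝ)}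
    (hZ : ∀ Φ ∈ Z, IsRipsCocycle r Φ) (hδ : 0 < δ) (hε : 0 < ε) (hr : 2 * δ + 2 * ε ≤ r)
    {N : Finset M} (hN : ∀ y, ∃ p ∈ N, dist p y < δ) {E₀ : Finset (M × M)}
    (hE₀ε : ∀ p ∈ E₀, dist p.1 p.2 ≤ ε) (hE₀ : CapturesRips Z s id E₀) :
    ∃ E : Finset (M × M), CapturesRips Z s id E ∧ (∀ p ∈ E, dist p.1 p.2 ≤ ε) ∧
      ∀ E' : Finset (M × M), CapturesRips Z s id E' → (∀ p ∈ E', dist p.1 p.2 ≤ ε) →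
        edgeSum id E ≤ edgeSum id E' := by
  classical
  obtain ⟨K, hK⟩ := exists_nat_gt (2 * ((N.card : ℝ) * N.card) + 2 * edgeSum id E₀ / ε)
  let A : Finset (Fin K × Fin K) → Set (Fin K → M) := fun e =>
    {x | (∀ p ∈ e, dist (x p.1) (x p.2) ≤ ε) ∧ CapturesRips Z s x e}
  have hA : ∀ e, IsClosed (A e) := by
    intro e
    refine isClosed_of_closure_subset fun x hx => ?_
    have hxε : ∀ p ∈ e, dist (x p.1) (x p.2) ≤ ε := fun p hp =>
      closure_minimal (s := A e) (t := {x | dist (x p.1) (x p.2) ≤ ε}) (fun y hy => hy.1 p hp)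
        (isClosed_le (by fun_prop) continuous_const) hx
    obtain ⟨y, hy, hxy⟩ := Metric.mem_closure_iff.1 hx ε hε
    exact ⟨hxε, hy.2.of_dist_lt hZ hε (by linarith) hxε ((dist_pi_lt_iff hε).1 hxy)⟩
  -- The lengths of all admissible systems on `K` labelled vertices: a finite union of compact sets.
  -- By the choice of `K`, every admissible system no longer than `E₀` is matched by an element of
  -- `T` at most its length.
  let T : Set ℝ := ⋃ e, (fun x => edgeSum x e) '' A e
  have hT : IsCompact T := isCompact_iUnion fun e => (hA e).isCompact.image <|
    continuous_finsetSum _ fun p _ => (continuous_apply p.1).dist (continuous_apply p.2)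
  have hreal : ∀ E : Finset (M × M), CapturesRips Z s id E → (∀ p ∈ E, dist p.1 p.2 ≤ ε) →
      edgeSum id E ≤ edgeSum id E₀ → ∃ t ∈ T, t ≤ edgeSum id E := by
    intro E hE hEε hEE₀
    obtain ⟨E', V, hE', hE'ε, hsum, hV, hcard⟩ := hE.exists_card_le hZ hδ hε hr hN hEε
    have hVK : V.card < K := by
      have h1 : 2 * edgeSum id E / ε ≤ 2 * edgeSum id E₀ / ε := by gcongr
      exact_mod_cast (show (V.card : ℝ) < K by linarith)
    obtain ⟨x, e, hx, hxE, hxs⟩ := hE'.exists_fin hV hVK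
    refine ⟨edgeSum x e, mem_iUnion.2 ⟨e, x, ⟨fun q hq => ?_, hx⟩, rfl⟩, hxs.le.trans hsum⟩
    obtain ⟨p, hp, h1, h2⟩ := hxE q hq
    rw [h1, h2]
    exact hE'ε p hp
  obtain ⟨t₀, ht₀, ht₀'⟩ := hreal E₀ hE₀ hE₀ε le_rfl
  obtain ⟨t, ht, hmin⟩ := hT.exists_isLeast ⟨t₀, ht₀⟩
  obtain ⟨e, x, ⟨hxε, hx⟩, rfl⟩ := mem_iUnion.1 ht
  -- Labels may share a position, so edges may coincide in `M`; merging them can only shorten the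
  -- system.
  have hsum : edgeSum id (e.image fun p => (x p.1, x p.2)) ≤ edgeSum x e :=
    Finset.sum_image_le_of_nonneg (f := fun q : M × M => dist q.1 q.2) fun _ _ => dist_nonneg
  refine ⟨e.image fun p => (x p.1, x p.2), fun Φ hΦ ⟨f, hf⟩ => ?_, fun q hq => ?_,
    fun E' hE' hE'ε => ?_⟩
  · exact hx Φ hΦ ⟨f ∘ x, fun p hp => hf _ (Finset.mem_image_of_mem _ hp)⟩
  · obtain ⟨p, hp, rfl⟩ := Finset.mem_image.1 hq
    exact hxε p hp
  · rcases le_total (edgeSum id E') (edgeSum id E₀) with h | h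
    · obtain ⟨t', ht', htE'⟩ := hreal E' hE' hE'ε h
      exact hsum.trans ((hmin ht').trans htE')
    · exact hsum.trans ((hmin ht₀).trans (ht₀'.trans h))
end

/-! ### Graphs as CW complexes: assembling arcs and cutting into pieces -/

/-- A continuous injection from a compact set to a Hausdorff space is an embedding. This supplies
the continuous inverses required of characteristic maps. -/
theorem continuousOn_leftInverse_of_isCompact {X Y : Type*} [TopologicalSpace X]
    [TopologicalSpace Y] [T2Space Y] {f : X → Y} {K S : Set X} (hK : IsCompact K)
    (hf : ContinuousOn f K) (hinj : InjOn f K) (hSK : S ⊆ K) {g : Y → X}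
    (hg : ∀ x ∈ S, g (f x) = x) : ContinuousOn g (f '' S) := by
  have : CompactSpace K := isCompact_iff_compactSpace.1 hK
  have hemb : IsEmbedding (K.domRestrict f) :=
    (hf.domRestrict.isClosedEmbedding hinj.injective).isEmbedding
  have hh : ∀ y : f '' S, ∃ x : K, (x : X) ∈ S ∧ f x = y := by
    rintro ⟨_, x, hx, rfl⟩
    exact ⟨⟨x, hSK hx⟩, hx, rfl⟩
  choose h hhS hhf using hh
  rw [continuousOn_iff_continuous_domRestrict]
  have hcont : Continuous h := by
    rw [hemb.continuous_iff]
    have : K.domRestrict f ∘ h = Subtype.val := funext hhf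
    rw [this]
    exact continuous_subtype_val
  have : (f '' S).domRestrict g = fun y => (h y : X) := by
    funext y
    exact (congrArg g (hhf y)).symm.trans (hg _ (hhS y))
  rw [this]
  exact continuous_subtype_val.comp hcont

/-- The cells of a graph with vertex set `P` and edge set `J`. -/
def GraphCell (P J : Type u) : ℕ → Type u
  | 0 => P
  | 1 => J
  | _ => PEmpty

/-- The characteristic maps of a graph with edges `φ`. -/
def graphCellMap {M : Type u} {P : Set M} {J : Type u} (φ : J → ℝ → M) :
    ∀ n, GraphCell P J n → (Fin n → ℝ) → M
  | 0, p, _ => p.1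
  | 1, j, v => φ j (v 0)
  | (_ + 2), i, _ => i.elim

/-- A finite set of points together with finitely many arcs that are disjoint apart from their
endpoints is a graph. -/
theorem isGraphIn_of_edges {M : Type u} [TopologicalSpace M] [T2Space M] {P : Set M}
    (hP : P.Finite) (hne : P.Nonempty) {J : Type u} [Finite J] {φ : J → ℝ → M}
    (hc : ∀ j, ContinuousOn (φ j) (Icc (-1) 1)) (hi : ∀ j, InjOn (φ j) (Icc (-1) 1))
    (hl : ∀ j, φ j (-1) ∈ P) (hr : ∀ j, φ j 1 ∈ P) (hd : ∀ j, ∀ t ∈ Ioo (-1 : ℝ) 1, φ j t ∉ P)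
    (hdd : ∀ j j', j ≠ j' → Disjoint (φ j '' Ioo (-1) 1) (φ j' '' Ioo (-1) 1)) :
    IsGraphIn (P ∪ ⋃ j, φ j '' Icc (-1) 1) := by
  refine ⟨hne.mono subset_union_left, ?_⟩
  have hball0 : ∀ s : Set (Fin 0 → ℝ), 0 ∈ s → s = univ := fun s hs =>
    eq_univ_of_forall fun v => by rwa [Subsingleton.elim v 0]
  have hball : ∀ v : Fin 1 → ℝ, v ∈ Metric.ball (0 : Fin 1 → ℝ) 1 ↔ v 0 ∈ Ioo (-1 : ℝ) 1 := by
    intro v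
    rw [mem_ball_zero_iff, pi_norm_lt_iff one_pos]
    simp [Fin.forall_fin_one, abs_lt]
  have hcball : ∀ v : Fin 1 → ℝ, v ∈ Metric.closedBall (0 : Fin 1 → ℝ) 1 ↔
      v 0 ∈ Icc (-1 : ℝ) 1 := by
    intro v
    rw [mem_closedBall_zero_iff, pi_norm_le_iff_of_nonneg zero_le_one]
    simp [Fin.forall_fin_one, abs_le]
  have hinj : ∀ n (i : GraphCell P J n), InjOn (graphCellMap φ n i) (Metric.closedBall 0 1)
    | 0, p => fun v _ w _ _ => Subsingleton.elim v w
    | 1, j => fun v hv w hw h => funext fun k => by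
        rw [Fin.fin_one_eq_zero k]
        exact hi j ((hcball v).1 hv) ((hcball w).1 hw) h
    | (_ + 2), i => i.elim
  have hcont : ∀ n (i : GraphCell P J n),
      ContinuousOn (graphCellMap φ n i) (Metric.closedBall 0 1)
    | 0, p => continuousOn_const
    | 1, j => (hc j).comp (continuous_apply 0).continuousOn fun v hv => (hcball v).1 hv
    | (_ + 2), i => i.elim
  have himg0 : ∀ (p : P) (s : Set (Fin 0 → ℝ)), 0 ∈ s → graphCellMap φ 0 p '' s = {p.1} := by
    intro p s hs
    rw [hball0 s hs]
    exact image_univ.trans range_const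
  have himg1 : ∀ (j : J), graphCellMap (P := P) φ 1 j '' Metric.ball 0 1 = φ j '' Ioo (-1) 1 := by
    intro j
    ext y
    constructor
    · rintro ⟨v, hv, rfl⟩
      exact ⟨v 0, (hball v).1 hv, rfl⟩
    · rintro ⟨t, ht, rfl⟩
      exact ⟨fun _ => t, (hball _).2 ht, rfl⟩
  have himg1' : ∀ (j : J),
      graphCellMap (P := P) φ 1 j '' Metric.closedBall 0 1 = φ j '' Icc (-1) 1 := by
    intro j
    ext y
    constructor
    · rintro ⟨v, hv, rfl⟩
      exact ⟨v 0, (hcball v).1 hv, rfl⟩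
    · rintro ⟨t, ht, rfl⟩
      exact ⟨fun _ => t, (hcball _).2 ht, rfl⟩
  have hempty : ∀ᶠ n in atTop, IsEmpty (GraphCell P J n) := by
    filter_upwards [eventually_ge_atTop 2] with n hn
    obtain ⟨m, rfl⟩ := Nat.exists_eq_add_of_le' hn
    exact inferInstanceAs (IsEmpty PEmpty)
  have hfin : ∀ n, Finite (GraphCell P J n)
    | 0 => hP.to_subtype
    | 1 => ‹Finite J›
    | (_ + 2) => inferInstanceAs (Finite PEmpty)
  have hdisj : (univ : Set (Σ n, GraphCell P J n)).PairwiseDisjoint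
      fun ni => graphCellMap φ ni.1 ni.2 '' Metric.ball 0 1 := by
    have h01 : ∀ (p : P) (j : J), Disjoint (graphCellMap φ 0 p '' Metric.ball 0 1)
        (graphCellMap (P := P) φ 1 j '' Metric.ball 0 1) := by
      intro p j
      rw [himg0 p _ (Metric.mem_ball_self one_pos), himg1, disjoint_singleton_left]
      rintro ⟨t, ht, h⟩
      exact hd j t ht (h ▸ p.2)
    rintro ⟨n, i⟩ - ⟨m, k⟩ - hne
    match n, i, m, k with
    | 0, p, 0, q =>
      change Disjoint (graphCellMap φ 0 p '' _) (graphCellMap φ 0 q '' _)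
      rw [himg0 p _ (Metric.mem_ball_self one_pos), himg0 q _ (Metric.mem_ball_self one_pos),
        disjoint_singleton]
      intro h
      exact hne (by rw [Subtype.ext h])
    | 0, p, 1, j => exact h01 p j
    | 1, j, 0, p => exact (h01 p j).symm
    | 1, j, 1, j' =>
      change Disjoint (graphCellMap φ 1 j '' _) (graphCellMap φ 1 j' '' _)
      exact (hdd j j' fun h => hne (by rw [h])).mono (himg1 j).subset (himg1 j').subset
    | (_ + 2), i, _, _ => exact i.elim
    | _, _, (_ + 2), i => exact i.elim
  have hfront : ∀ n (i : GraphCell P J n), MapsTo (graphCellMap φ n i) (Metric.sphere 0 1)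
      (⋃ (m < n) (j : GraphCell P J m), graphCellMap φ m j '' Metric.closedBall 0 1)
    | 0, p => fun v hv => by
        rw [Subsingleton.elim v 0, mem_sphere_zero_iff_norm, norm_zero] at hv
        exact absurd hv zero_ne_one
    | 1, j => fun v hv => by
        have hv' : |v 0| = 1 := by
          rw [mem_sphere_zero_iff_norm] at hv
          have h1 : ‖v 0‖ ≤ ‖v‖ := norm_le_pi_norm v 0
          have h2 : ‖v‖ ≤ ‖v 0‖ := (pi_norm_le_iff_of_nonneg (norm_nonneg _)).2 fun k => by
            rw [Fin.fin_one_eq_zero k]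
          rw [← Real.norm_eq_abs]
          linarith
        have hmem : φ j (v 0) ∈ P := by
          rcases eq_or_eq_neg_of_abs_eq hv' with h | h <;> rw [h]
          exacts [hr j, hl j]
        refine mem_iUnion₂.2 ⟨0, zero_lt_one, mem_iUnion.2 ⟨⟨_, hmem⟩, ?_⟩⟩
        exact ⟨0, Metric.mem_closedBall_self zero_le_one, rfl⟩
    | (_ + 2), i => i.elim
  have hunion : ⋃ (n) (i : GraphCell P J n), graphCellMap φ n i '' Metric.closedBall 0 1 =
      P ∪ ⋃ j, φ j '' Icc (-1) 1 := by
    refine Subset.antisymm (iUnion₂_subset ?_) (union_subset ?_ (iUnion_subset ?_))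
    · intro n i
      match n, i with
      | 0, p =>
        rw [himg0 p _ (Metric.mem_closedBall_self zero_le_one), singleton_subset_iff]
        exact Or.inl p.2
      | 1, j =>
        exact (himg1' j).subset.trans
          ((subset_iUnion (fun j => φ j '' Icc (-1) 1) j).trans subset_union_right)
      | (_ + 2), i => exact i.elim
    · intro p hp
      refine mem_iUnion₂.2 ⟨0, ⟨p, hp⟩, ?_⟩
      exact ⟨0, Metric.mem_closedBall_self zero_le_one, rfl⟩
    · intro j
      rw [← himg1' j]
      exact subset_iUnion₂ (s := fun n (i : GraphCell P J n) =>
        graphCellMap φ n i '' Metric.closedBall 0 1) 1 j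
  let C : Topology.CWComplex (P ∪ ⋃ j, φ j '' Icc (-1) 1) :=
    Topology.CWComplex.mkFinite _ (GraphCell P J)
      (fun n i => InjOn.toPartialEquiv (graphCellMap φ n i) (Metric.ball 0 1)
        ((hinj n i).mono Metric.ball_subset_closedBall))
      hempty
      hfin
      (fun _ _ => rfl)
      hcont
      (fun n i => continuousOn_leftInverse_of_isCompact (isCompact_closedBall 0 1) (hcont n i)
        (hinj n i) Metric.ball_subset_closedBall fun v hv =>
          ((hinj n i).mono Metric.ball_subset_closedBall).leftInvOn_invFunOn hv)
      hdisj
      hfront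
      hunion
  exact ⟨C, Topology.CWComplex.finite_mkFinite _ (GraphCell P J) _ hempty hfin _ _ _ _ _ _,
    fun n hn => by
      obtain ⟨m, rfl⟩ := Nat.exists_eq_add_of_le' hn
      exact inferInstanceAs (IsEmpty PEmpty)⟩

/-- A subset that is the image of a compact interval under a continuous injective map. -/
def IsArc {M : Type*} [TopologicalSpace M] (A : Set M) : Prop :=
  ∃ (γ : ℝ → M) (a b : ℝ), a ≤ b ∧ ContinuousOn γ (Icc a b) ∧ InjOn γ (Icc a b) ∧
    A = γ '' Icc a b

/-- A finite nonempty family of arcs with pairwise finite intersections has a graph as union. -/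
theorem isGraphIn_sUnion_of_isArc {M : Type u} [TopologicalSpace M] [T2Space M] {F : Set (Set M)}
    (hF : F.Finite) (hne : F.Nonempty) (harc : ∀ A ∈ F, IsArc A)
    (hpair : ∀ A ∈ F, ∀ B ∈ F, A ≠ B → (A ∩ B).Finite) : IsGraphIn (⋃₀ F) := by
  have hM : Nonempty M := by
    obtain ⟨A, hA⟩ := hne
    exact (harc A hA).elim fun γ _ => ⟨γ 0⟩
  have : Finite F := hF
  choose γ a b hab hγ hinj hAγ using fun A : F => harc A.1 A.2
  -- The vertices are the end points and pairwise intersections of the arcs. The edges `J` are pairs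
  -- of consecutive parameters of vertices on an arc, and `L` rescales `[-1, 1]` to the interval
  -- between them.
  let P : Set M := (⋃ A : F, ⋃ B : F, ⋃ _ : A ≠ B, A.1 ∩ B.1) ∪ ⋃ A : F, {γ A (a A), γ A (b A)}
  have hP : P.Finite := by
    refine (finite_iUnion fun A => finite_iUnion fun B => finite_iUnion fun h => ?_).union
      (finite_iUnion fun A => toFinite _)
    exact hpair _ A.2 _ B.2 fun h' => h (Subtype.ext h')
  have hPF : P ⊆ ⋃₀ F := by
    refine union_subset (iUnion_subset fun A => iUnion_subset fun B => iUnion_subset fun _ =>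
      inter_subset_left.trans (subset_sUnion_of_mem A.2)) (iUnion_subset fun A => ?_)
    refine Subset.trans ?_ (subset_sUnion_of_mem A.2)
    rw [hAγ A, pair_subset_iff]
    exact ⟨mem_image_of_mem _ ⟨le_rfl, hab A⟩, mem_image_of_mem _ ⟨hab A, le_rfl⟩⟩
  have hPa : ∀ A, γ A (a A) ∈ P := fun A => Or.inr (mem_iUnion.2 ⟨A, Or.inl rfl⟩)
  have hPb : ∀ A, γ A (b A) ∈ P := fun A => Or.inr (mem_iUnion.2 ⟨A, Or.inr rfl⟩)
  have hPne : P.Nonempty := ⟨_, hPa ⟨_, hne.some_mem⟩⟩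
  let T : F → Set ℝ := fun A => {t | t ∈ Icc (a A) (b A) ∧ γ A t ∈ P}
  have hT : ∀ A, (T A).Finite := fun A =>
    Finite.of_finite_image (hP.subset (by rintro _ ⟨t, ht, rfl⟩; exact ht.2))
      ((hinj A).mono fun t ht => ht.1)
  let J := {q : F × ℝ × ℝ // q.2.1 ∈ T q.1 ∧ q.2.2 ∈ T q.1 ∧ q.2.1 < q.2.2 ∧
    ∀ t ∈ Ioo q.2.1 q.2.2, t ∉ T q.1}
  have : Finite J := by
    have h1 : (⋃ A : F, (fun p : ℝ × ℝ => (A, p)) '' (T A ×ˢ T A)).Finite :=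
      finite_iUnion fun A => ((hT A).prod (hT A)).image _
    exact h1.subset (s := _) (fun q hq => mem_iUnion.2 ⟨q.1, q.2, ⟨hq.1, hq.2.1⟩, rfl⟩)
  let L : J → ℝ → ℝ := fun q t => (q.1.2.1 + q.1.2.2) / 2 + (q.1.2.2 - q.1.2.1) / 2 * t
  have hLc : ∀ q, Continuous (L q) := fun q => by fun_prop
  have hL1 : ∀ q, L q 1 = q.1.2.2 := fun q => by simp only [L]; ring
  have hL0 : ∀ q, L q (-1) = q.1.2.1 := fun q => by simp only [L]; ring
  have hLmono : ∀ q, StrictMono (L q) := fun q s t hst => by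
    have := mul_lt_mul_of_pos_left hst (half_pos (sub_pos.2 q.2.2.2.1))
    simp only [L]
    linarith
  have hLIcc : ∀ q, L q '' Icc (-1) 1 = Icc q.1.2.1 q.1.2.2 := by
    intro q
    rw [← hL0 q, ← hL1 q]
    refine Subset.antisymm ?_ (intermediate_value_Icc (by norm_num) (hLc q).continuousOn)
    rintro _ ⟨t, ht, rfl⟩
    exact ⟨(hLmono q).monotone ht.1, (hLmono q).monotone ht.2⟩
  have hLIoo : ∀ q, ∀ t ∈ Ioo (-1 : ℝ) 1, L q t ∈ Ioo q.1.2.1 q.1.2.2 := by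
    intro q t ht
    rw [← hL0 q, ← hL1 q]
    exact ⟨hLmono q ht.1, hLmono q ht.2⟩
  have hsub : ∀ q : J, Icc q.1.2.1 q.1.2.2 ⊆ Icc (a q.1.1) (b q.1.1) := fun q =>
    Icc_subset_Icc q.2.1.1.1 q.2.2.1.1.2
  have hmaps : ∀ q, MapsTo (L q) (Icc (-1) 1) (Icc (a q.1.1) (b q.1.1)) := fun q t ht =>
    hsub q (hLIcc q ▸ mem_image_of_mem _ ht)
  have hdP : ∀ q : J, ∀ t ∈ Ioo (-1 : ℝ) 1, γ q.1.1 (L q t) ∉ P := fun q t ht h =>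
    q.2.2.2.2 _ (hLIoo q t ht) ⟨hmaps q (Ioo_subset_Icc_self ht), h⟩
  have key := isGraphIn_of_edges hP hPne (J := J) (φ := fun q t => γ q.1.1 (L q t))
    (fun q => (hγ q.1.1).comp (hLc q).continuousOn (hmaps q))
    (fun q => (hinj q.1.1).comp (hLmono q).injective.injOn (hmaps q))
    (fun q => by rw [hL0]; exact q.2.1.2) (fun q => by rw [hL1]; exact q.2.2.1.2) hdP (by
      intro q q' hqq'
      rw [disjoint_left]
      rintro _ ⟨t, ht, rfl⟩ ⟨t', ht', h⟩
      have hu := hmaps q (Ioo_subset_Icc_self ht)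
      have hu' := hmaps q' (Ioo_subset_Icc_self ht')
      by_cases hA : q.1.1 = q'.1.1
      · refine hqq' ?_
        have h1 := hLIoo q t ht
        have h2 := hLIoo q' t' ht'
        simp only at h
        generalize L q t = x at *
        generalize L q' t' = x' at *
        obtain ⟨⟨A, l, r⟩, hl, hr, hlr, hgap⟩ := q
        obtain ⟨⟨A', l', r'⟩, hl', hr', hlr', hgap'⟩ := q'
        simp only at hA h1 h2 hu hu' h hl hr hlr hgap hl' hr' hlr' hgap'
        subst hA
        obtain rfl : x' = x := hinj A hu' hu h
        have e1 : l = l' := by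
          rcases lt_trichotomy l l' with hlt | heq | hlt
          · exact absurd hl' (hgap l' ⟨hlt, h2.1.trans h1.2⟩)
          · exact heq
          · exact absurd hl (hgap' l ⟨hlt, h1.1.trans h2.2⟩)
        have e2 : r = r' := by
          rcases lt_trichotomy r r' with hlt | heq | hlt
          · exact absurd hr (hgap' r ⟨h2.1.trans h1.2, hlt⟩)
          · exact heq
          · exact absurd hr' (hgap r' ⟨h1.1.trans h2.2, hlt⟩)
        subst e1 e2
        rfl
      · refine hdP q t ht (Or.inl (mem_iUnion.2 ⟨q.1.1, mem_iUnion.2 ⟨q'.1.1,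
          mem_iUnion.2 ⟨hA, ?_, ?_⟩⟩⟩))
        · rw [hAγ]
          exact mem_image_of_mem _ hu
        · rw [hAγ]
          exact ⟨_, hu', h⟩)
  have hun : P ∪ ⋃ q : J, (fun t => γ q.1.1 (L q t)) '' Icc (-1) 1 = ⋃₀ F := by
    refine Subset.antisymm (union_subset hPF (iUnion_subset fun q => ?_)) ?_
    · refine Subset.trans ?_ (subset_sUnion_of_mem q.1.1.2)
      rw [hAγ]
      rintro _ ⟨t, ht, rfl⟩
      exact mem_image_of_mem _ (hmaps q ht)
    · rintro y ⟨A, hA, hy⟩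
      have hy' : y ∈ ((⟨A, hA⟩ : F) : Set M) := hy
      generalize (⟨A, hA⟩ : F) = B at hy'
      rw [hAγ B] at hy'
      obtain ⟨t, ht, rfl⟩ := hy'
      by_cases htP : γ B t ∈ P
      · exact Or.inl htP
      · right
        have hTc : IsCompact (T B) := (hT B).isCompact
        obtain ⟨l, ⟨hl, hlt⟩, hlmax⟩ := (hTc.inter_right isClosed_Iic).exists_isGreatest
          ⟨a B, ⟨⟨le_rfl, hab B⟩, hPa B⟩, ht.1⟩
        obtain ⟨r, ⟨hr, hrt⟩, hrmin⟩ := (hTc.inter_right isClosed_Ici).exists_isLeast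
          ⟨b B, ⟨⟨hab B, le_rfl⟩, hPb B⟩, ht.2⟩
        have hlt' : l < t := lt_of_le_of_ne hlt fun h => htP (h ▸ hl.2)
        have hrt' : t < r := lt_of_le_of_ne hrt fun h => htP (h.symm ▸ hr.2)
        let q : J := ⟨(B, l, r), hl, hr, hlt'.trans hrt', fun x hx hxT => by
          rcases le_total x t with h | h
          · exact (hlmax ⟨hxT, h⟩).not_gt hx.1
          · exact (hrmin ⟨hxT, h⟩).not_gt hx.2⟩
        have htq : t ∈ L q '' Icc (-1) 1 := by
          rw [hLIcc q]
          exact ⟨hlt, hrt⟩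
        obtain ⟨x, hx, hxt⟩ := htq
        exact mem_iUnion.2 ⟨q, x, hx, congrArg (γ B) hxt⟩
  rw [hun] at key
  exact key

theorem exists_mem_Icc_subdivision {n : ℕ} (hn : 0 < n) {t : ℝ} (ht : t ∈ Icc (-1 : ℝ) 1) :
    ∃ k : Fin n, t ∈ Icc (-1 + 2 * (k : ℝ) / n) (-1 + 2 * ((k : ℝ) + 1) / n) := by
  have hn' : (0 : ℝ) < n := by exact_mod_cast hn
  have h0 : 0 ≤ (t + 1) / 2 * n := by
    have := ht.1
    have : 0 ≤ (t + 1) / 2 := by linarith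
    positivity
  rcases ht.2.lt_or_eq with h1 | rfl
  · have hlt : ⌊(t + 1) / 2 * n⌋₊ < n := by
      rw [Nat.floor_lt h0]
      have : (t + 1) / 2 < 1 := by linarith
      nlinarith
    refine ⟨⟨_, hlt⟩, ?_, ?_⟩
    · have := Nat.floor_le h0
      have h2 : 2 * (⌊(t + 1) / 2 * n⌋₊ : ℝ) / n ≤ t + 1 := by
        rw [div_le_iff₀ hn']
        linarith
      simp only
      linarith
    · have := Nat.lt_floor_add_one ((t + 1) / 2 * n)
      have h2 : t + 1 ≤ 2 * ((⌊(t + 1) / 2 * n⌋₊ : ℝ) + 1) / n := by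
        rw [le_div_iff₀ hn']
        linarith
      simp only
      linarith
  -- At `t = 1` the floor would be `n`, so the last interval is used.
  · refine ⟨⟨n - 1, by omega⟩, ?_⟩
    have h1 : ((n - 1 : ℕ) : ℝ) = n - 1 := by
      rw [Nat.cast_sub (by omega), Nat.cast_one]
    simp only [h1]
    have e1 : 2 * ((n : ℝ) - 1 + 1) / n = 2 := by field_simp; ring
    have e2 : 2 * ((n : ℝ) - 1) / n ≤ 2 := by
      rw [div_le_iff₀ hn']
      linarith
    constructor <;> linarith

/-- A graph is a finite union of small connected pieces, each with two marked points, which meet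
only in marked points. -/
theorem IsGraphIn.exists_pieces {M : Type u} [MetricSpace M] {Γ : Set M} (hΓ : IsGraphIn Γ) {ε : ℝ}
    (hε : 0 < ε) : ∃ (ι : Type u) (_ : Finite ι) (Q : ι → Set M) (x y : ι → M),
      (∀ i, IsCompact (Q i)) ∧ (∀ i, IsPreconnected (Q i)) ∧ (∀ i, x i ∈ Q i) ∧ (∀ i, y i ∈ Q i) ∧
      (∀ i, ∀ z ∈ Q i, ∀ w ∈ Q i, dist z w ≤ ε) ∧
      (∀ i j, i ≠ j → Q i ∩ Q j ⊆ {x i, y i}) ∧ Γ = ⋃ i, Q i := by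
  obtain ⟨-, C, hfin, hC⟩ := hΓ
  have hfc : ∀ n, Finite (C.cell n) := fun n => hfin.toFiniteType.finite_cell n
  let g : C.cell 1 → ℝ → M := fun j t => Topology.CWComplex.map (C := Γ) 1 j fun _ => t
  let v : C.cell 0 → M := fun i => Topology.CWComplex.map (C := Γ) 0 i 0
  have hball : ∀ t : ℝ, (fun _ => t : Fin 1 → ℝ) ∈ Metric.ball (0 : Fin 1 → ℝ) 1 ↔
      t ∈ Ioo (-1 : ℝ) 1 := by
    intro t
    rw [mem_ball_zero_iff, pi_norm_lt_iff one_pos]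
    simp [abs_lt]
  have hcball : ∀ t : ℝ, (fun _ => t : Fin 1 → ℝ) ∈ Metric.closedBall (0 : Fin 1 → ℝ) 1 ↔
      t ∈ Icc (-1 : ℝ) 1 := by
    intro t
    rw [mem_closedBall_zero_iff, pi_norm_le_iff_of_nonneg zero_le_one]
    simp [abs_le]
  have hgc : ∀ j, ContinuousOn (g j) (Icc (-1) 1) := fun j =>
    (Topology.CWComplex.continuousOn (C := Γ) 1 j).comp
      (continuous_pi fun _ => continuous_id).continuousOn fun t ht => (hcball t).2 ht
  have hopen : ∀ j, ∀ t ∈ Ioo (-1 : ℝ) 1, g j t ∈ Topology.CWComplex.openCell (C := Γ) 1 j :=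
    fun j t ht => mem_image_of_mem _ ((hball t).2 ht)
  have hginj : ∀ j j', ∀ t ∈ Ioo (-1 : ℝ) 1, ∀ t' ∈ Ioo (-1 : ℝ) 1, g j t = g j' t' →
      j = j' ∧ t = t' := by
    intro j j' t ht t' ht' h
    have hj : j = j' := by
      by_contra hne
      exact (Topology.CWComplex.disjoint_openCell_of_ne (C := Γ) (i := j) (j := j')
        (by simpa using hne)).ne_of_mem (hopen j t ht) (hopen j' t' ht') h
    subst hj
    refine ⟨rfl, ?_⟩
    have := (Topology.CWComplex.map (C := Γ) 1 j).injOn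
      (by rw [Topology.CWComplex.source_eq]; exact (hball t).2 ht)
      (by rw [Topology.CWComplex.source_eq]; exact (hball t').2 ht') h
    exact congrFun this 0
  have hgv : ∀ j, ∀ t ∈ Ioo (-1 : ℝ) 1, ∀ i, g j t ≠ v i := by
    intro j t ht i
    refine (Topology.CWComplex.disjoint_openCell_of_ne (C := Γ) (i := j) (j := i)
        (by simp)).ne_of_mem (hopen j t ht) ?_
    exact mem_image_of_mem _ (Metric.mem_ball_self one_pos)
  have hgend : ∀ j t, |t| = 1 → ∃ i, g j t = v i := by
    intro j t ht
    obtain ⟨I, hI⟩ := Topology.CWComplex.mapsTo (C := Γ) 1 j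
    have hmem := hI (show (fun _ => t : Fin 1 → ℝ) ∈ Metric.sphere 0 1 by
      rw [mem_sphere_zero_iff_norm, pi_norm_const, Real.norm_eq_abs, ht])
    simp only [mem_iUnion] at hmem
    obtain ⟨m, hm, i, -, w, -, hw⟩ := hmem
    obtain rfl : m = 0 := by omega
    rw [Subsingleton.elim w 0] at hw
    exact ⟨i, hw.symm⟩
  obtain ⟨n, hn, hn0⟩ : ∃ n : ℕ, (∀ j, ∀ s ∈ Icc (-1 : ℝ) 1, ∀ t ∈ Icc (-1 : ℝ) 1,
      |s - t| ≤ 2 / n → dist (g j s) (g j t) ≤ ε) ∧ 0 < n := by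
    refine Eventually.exists (f := atTop) ((eventually_all.2 fun j => ?_).and
      (eventually_gt_atTop 0))
    obtain ⟨δ, hδ, h⟩ := Metric.uniformContinuousOn_iff.1
      (isCompact_Icc.uniformContinuousOn_of_continuous (hgc j)) ε hε
    have hlim : Tendsto (fun n : ℕ => (2 : ℝ) / n) atTop (𝓝 0) :=
      tendsto_const_div_atTop_nhds_zero_nat 2
    filter_upwards [hlim.eventually (gt_mem_nhds hδ)] with n hn s hs t ht hst
    exact (h s hs t ht (hst.trans_lt hn)).le
  have hn' : (0 : ℝ) < n := by exact_mod_cast hn0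
  let l : Fin n → ℝ := fun k => -1 + 2 * (k : ℝ) / n
  let u : Fin n → ℝ := fun k => -1 + 2 * ((k : ℝ) + 1) / n
  have hul : ∀ k, u k - l k = 2 / n := fun k => by simp only [l, u]; ring
  have hlu : ∀ k, l k ≤ u k := fun k => by
    have := hul k
    have : 0 < 2 / (n : ℝ) := by positivity
    linarith
  have hl : ∀ k, -1 ≤ l k := fun k => by
    have : 0 ≤ 2 * (k : ℝ) / n := by positivity
    simp only [l]
    linarith
  have hu : ∀ k, u k ≤ 1 := fun k => by
    have h1 : ((k : ℕ) : ℝ) + 1 ≤ n := by exact_mod_cast k.2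
    have : 2 * ((k : ℝ) + 1) / n ≤ 2 := by
      rw [div_le_iff₀ hn']
      linarith
    simp only [u]
    linarith
  have hulk : ∀ k k' : Fin n, k < k' → u k ≤ l k' := fun k k' h => by
    have h1 : ((k : ℕ) : ℝ) + 1 ≤ (k' : ℕ) := by exact_mod_cast h
    simp only [l, u]
    gcongr
  have hsub : ∀ k, Icc (l k) (u k) ⊆ Icc (-1) 1 := fun k => Icc_subset_Icc (hl k) (hu k)
  -- The pieces are the vertices as single points, which also covers isolated ones, and `n` equal
  -- parameter subintervals of each edge, with `n` from uniform continuity. The marked points are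
  -- the ends.
  refine ⟨C.cell 0 ⊕ C.cell 1 × Fin n, inferInstance,
    Sum.elim (fun i => {v i}) (fun p => g p.1 '' Icc (l p.2) (u p.2)),
    Sum.elim v (fun p => g p.1 (l p.2)), Sum.elim v (fun p => g p.1 (u p.2)), ?_, ?_, ?_, ?_, ?_,
    ?_, ?_⟩
  · rintro (i | p)
    · exact isCompact_singleton
    · exact isCompact_Icc.image_of_continuousOn ((hgc p.1).mono (hsub p.2))
  · rintro (i | p)
    · exact isPreconnected_singleton
    · exact isPreconnected_Icc.image _ ((hgc p.1).mono (hsub p.2))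
  · rintro (i | p)
    · exact mem_singleton _
    · exact mem_image_of_mem _ ⟨le_rfl, hlu p.2⟩
  · rintro (i | p)
    · exact mem_singleton _
    · exact mem_image_of_mem _ ⟨hlu p.2, le_rfl⟩
  · rintro (i | p)
    · rintro z rfl w rfl
      rw [dist_self]
      exact hε.le
    · rintro _ ⟨s, hs, rfl⟩ _ ⟨t, ht, rfl⟩
      refine hn _ _ (hsub _ hs) _ (hsub _ ht) ?_
      rw [← hul p.2]
      exact abs_sub_le_of_le_of_le hs.1 hs.2 ht.1 ht.2
  · rintro (i | ⟨j, k⟩) b hne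
    · exact inter_subset_left.trans (by simp)
    -- An unmarked point of a subarc is interior to its 1-cell, where the characteristic map is
    -- injective and no vertex or other edge occurs.
    · rintro _ ⟨⟨t, ht, rfl⟩, hb⟩
      by_contra hcon
      have htl : l k < t := lt_of_le_of_ne ht.1 fun h => hcon (Or.inl (by rw [← h]; rfl))
      have htu : t < u k := lt_of_le_of_ne ht.2 fun h => hcon (Or.inr (by rw [h]; rfl))
      have ht' : t ∈ Ioo (-1 : ℝ) 1 := ⟨(hl k).trans_lt htl, htu.trans_le (hu k)⟩
      rcases b with i | ⟨j', k'⟩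
      · exact hgv j t ht' i hb
      · obtain ⟨t', ht1, h⟩ := hb
        have ht1' := hsub k' ht1
        rcases ht1'.1.eq_or_lt with h1 | h1
        · obtain ⟨i, hi⟩ := hgend j' t' (by rw [← h1]; simp)
          exact hgv j t ht' i (h ▸ hi)
        rcases ht1'.2.eq_or_lt with h2 | h2
        · obtain ⟨i, hi⟩ := hgend j' t' (by rw [h2]; simp)
          exact hgv j t ht' i (h ▸ hi)
        obtain ⟨rfl, rfl⟩ := hginj j' j t' ⟨h1, h2⟩ t ht' h
        rcases lt_trichotomy k k' with hk | rfl | hk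
        · have := hulk k k' hk
          linarith [ht1.1]
        · exact hne rfl
        · have := hulk k' k hk
          linarith [ht1.2]
  · have hun := Topology.CWComplex.union (C := Γ)
    refine Subset.antisymm (fun w hw => ?_) (iUnion_subset ?_)
    · rw [← hun] at hw
      obtain ⟨m, i, hi⟩ := mem_iUnion₂.1 hw
      match m, i with
      | 0, i =>
        refine mem_iUnion.2 ⟨Sum.inl i, ?_⟩
        obtain ⟨z, -, rfl⟩ := hi
        exact congrArg _ (Subsingleton.elim z 0)
      | 1, j =>
        obtain ⟨z, hz, rfl⟩ := hi
        have hz' : z = fun _ => z 0 := funext fun k => by rw [Fin.fin_one_eq_zero k]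
        rw [hz'] at hz
        obtain ⟨k, hk⟩ := exists_mem_Icc_subdivision hn0 ((hcball _).1 hz)
        refine mem_iUnion.2 ⟨Sum.inr (j, k), z 0, hk, ?_⟩
        exact congrArg _ hz'.symm
      | (m + 2), i => exact ((hC (m + 2) (by omega)).false i).elim
    · rintro (i | ⟨j, k⟩)
      · refine Subset.trans ?_ ((subset_iUnion₂ (s := fun n (i : C.cell n) =>
          Topology.CWComplex.closedCell (C := Γ) n i) 0 i).trans hun.subset)
        rintro _ rfl
        exact mem_image_of_mem _ (Metric.mem_closedBall_self zero_le_one)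
      · refine Subset.trans ?_ ((subset_iUnion₂ (s := fun n (i : C.cell n) =>
          Topology.CWComplex.closedCell (C := Γ) n i) 1 j).trans hun.subset)
        rintro _ ⟨t, ht, rfl⟩
        exact mem_image_of_mem _ ((hcball t).2 (hsub k ht))

/-! ### Lower bounds for length -/

section
variable {M : Type*} [MetricSpace M] [MeasurableSpace M] [BorelSpace M]

/-- The 1-Lipschitz function `dist x` maps `Q` onto a set containing `[0, dist x y]`. -/
theorem IsPreconnected.ofReal_dist_le_hausdorffMeasure {Q : Set M} (hQ : IsPreconnected Q) {x y : M}
    (hx : x ∈ Q) (hy : y ∈ Q) :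
    ENNReal.ofReal (dist x y) ≤ MeasureTheory.Measure.hausdorffMeasure 1 Q := by
  have h1 : Icc 0 (dist x y) ⊆ dist x '' Q := by
    have := (hQ.image (dist x) (by fun_prop)).ordConnected.out (mem_image_of_mem _ hx)
      (mem_image_of_mem _ hy)
    rwa [dist_self] at this
  have h2 := (LipschitzWith.dist_right x).hausdorffMeasure_image_le (zero_le_one (α := ℝ)) Q
  rw [ENNReal.coe_one, ENNReal.one_rpow, one_mul] at h2
  refine le_trans ?_ ((MeasureTheory.measure_mono h1).trans h2)
  rw [MeasureTheory.hausdorffMeasure_real, Real.volume_Icc, sub_zero]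

/-- Without their marked points, which are null, the pieces are disjoint, so their measures add up.
-/
theorem sum_ofReal_dist_le_hausdorffMeasure {ι : Type*} [Fintype ι] {Q : ι → Set M} {x y : ι → M}
    (hQc : ∀ i, IsCompact (Q i)) (hQ : ∀ i, IsPreconnected (Q i)) (hx : ∀ i, x i ∈ Q i)
    (hy : ∀ i, y i ∈ Q i) (hQQ : ∀ i j, i ≠ j → Q i ∩ Q j ⊆ {x i, y i}) :
    ∑ i, ENNReal.ofReal (dist (x i) (y i)) ≤
      MeasureTheory.Measure.hausdorffMeasure 1 (⋃ i, Q i) := by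
  have hnull : ∀ i, MeasureTheory.Measure.hausdorffMeasure 1 (Q i \ {x i, y i}) =
      MeasureTheory.Measure.hausdorffMeasure (X := M) 1 (Q i) := by
    intro i
    have := MeasureTheory.Measure.nullSingletonClass_hausdorff M (zero_lt_one (α := ℝ))
    exact MeasureTheory.measure_sdiff_null ((toFinite _).measure_zero _)
  calc ∑ i, ENNReal.ofReal (dist (x i) (y i))
      ≤ ∑ i, MeasureTheory.Measure.hausdorffMeasure 1 (Q i \ {x i, y i}) :=
        Finset.sum_le_sum fun i _ => by
          rw [hnull i]
          exact (hQ i).ofReal_dist_le_hausdorffMeasure (hx i) (hy i)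
    _ = MeasureTheory.Measure.hausdorffMeasure 1 (⋃ i, Q i \ {x i, y i}) := by
        rw [MeasureTheory.measure_iUnion, tsum_fintype]
        · intro i j hij
          rw [Function.onFun, disjoint_left]
          intro w hw hw'
          exact hw.2 (hQQ i j hij ⟨hw.1, hw'.1⟩)
        · exact fun i => (hQc i).measurableSet.diff (toFinite _).measurableSet
    _ ≤ _ := MeasureTheory.measure_mono (iUnion_mono fun i => sdiff_subset)
end

/-! ### Realising edges by arcs with finite intersections -/

section
variable {M : Type*} [MetricSpace M]

/-- The function `f` is a primitive of `Φ` on every member of a family of sets. -/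
def IsRipsPrimitive (Φ : M → M → ℝ) (f : M → ℝ) (F : Set (Set M)) : Prop :=
  ∀ A ∈ F, ∀ p ∈ A, ∀ q ∈ A, Φ p q = f q - f p

/-- A short arc may be replaced by finitely many of its subarcs which meet the members of a given
finite family in finite sets, without losing control of cocycles between its endpoints. -/
theorem exists_subarcs {r : ℝ} {γ : ℝ → M} {a₀ b₀ : ℝ} (hγ : ContinuousOn γ (Icc a₀ b₀))
    (hinj : InjOn γ (Icc a₀ b₀)) (hsmall : ∀ s ∈ Icc a₀ b₀, ∀ t ∈ Icc a₀ b₀, dist (γ s) (γ t) < r)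
    {F : Set (Set M)} (hF : F.Finite) (hFc : ∀ B ∈ F, IsClosed B) :
    ∀ a b, a ≤ b → a₀ ≤ a → b ≤ b₀ → ∃ F' : Set (Set M), F'.Finite ∧
      (∀ A ∈ F', ∃ s t, s ≤ t ∧ a ≤ s ∧ t ≤ b ∧ A = γ '' Icc s t) ∧
      (∀ A ∈ F', ∀ B ∈ F, (A ∩ B).Finite) ∧
      (∀ A ∈ F', ∀ B ∈ F', A ≠ B → (A ∩ B).Finite) ∧
      ∀ Φ f, IsRipsCocycle r Φ → IsRipsPrimitive Φ f F → IsRipsPrimitive Φ f F' →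
        Φ (γ a) (γ b) = f (γ b) - f (γ a) := by
  induction F, hF using Set.Finite.induction_on with
  | empty =>
    intro a b hab _ _
    refine ⟨{γ '' Icc a b}, finite_singleton _, ?_, by simp, ?_, fun Φ f _ _ h => ?_⟩
    · rintro A rfl
      exact ⟨a, b, hab, le_rfl, le_rfl, rfl⟩
    · rintro A rfl B rfl h
      exact absurd rfl h
    · exact h _ rfl _ (mem_image_of_mem _ ⟨le_rfl, hab⟩) _ (mem_image_of_mem _ ⟨hab, le_rfl⟩)
  | @insert B F hBF hF ih =>
    replace ih := ih fun B' hB' => hFc B' (mem_insert_of_mem B hB')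
    have hmono : ∀ {Φ f}, IsRipsPrimitive Φ f (insert B F) → IsRipsPrimitive Φ f F :=
      fun h A hA => h A (mem_insert_of_mem B hA)
    intro a b hab ha hb
    have hsub : Icc a b ⊆ Icc a₀ b₀ := Icc_subset_Icc ha hb
    have hcl : IsCompact (Icc a b ∩ γ ⁻¹' B) :=
      isCompact_Icc.of_isClosed_subset ((hγ.mono hsub).preimage_isClosed_of_isClosed isClosed_Icc
        (hFc B (mem_insert B F))) inter_subset_left
    rcases (Icc a b ∩ γ ⁻¹' B).eq_empty_or_nonempty with hemp | hne
    · obtain ⟨F', hF', hsubarc, hfin, hpair, hex⟩ := ih a b hab ha hb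
      refine ⟨F', hF', hsubarc, ?_, hpair, fun Φ f hΦ h h' => hex Φ f hΦ (hmono h) h'⟩
      rintro A hA B' (rfl | hB')
      · obtain ⟨s, t, -, hs, ht, rfl⟩ := hsubarc A hA
        convert finite_empty
        rw [eq_empty_iff_forall_notMem]
        rintro _ ⟨⟨x, hx, rfl⟩, hxB⟩
        exact eq_empty_iff_forall_notMem.1 hemp x ⟨⟨hs.trans hx.1, hx.2.trans ht⟩, hxB⟩
      · exact hfin A hA B' hB'
    -- Cut at the first and last parameters `l` and `u` in `B` and discard what lies between. The
    -- primitive on `B` already controls `Φ (γ l) (γ u)`, and the remaining parts meet `B` in at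
    -- most one point each.
    · obtain ⟨l, ⟨hl, hlB⟩, hlmin⟩ := hcl.exists_isLeast hne
      obtain ⟨u, ⟨hu, huB⟩, humax⟩ := hcl.exists_isGreatest hne
      have hlu : l ≤ u := hlmin ⟨hu, huB⟩
      obtain ⟨F₁, hF₁, hsub₁, hfin₁, hpair₁, hex₁⟩ := ih a l hl.1 ha (hl.2.trans hb)
      obtain ⟨F₂, hF₂, hsub₂, hfin₂, hpair₂, hex₂⟩ := ih u b hu.2 (ha.trans hu.1) hb
      have h12 : ∀ A ∈ F₁, ∀ A' ∈ F₂, (A ∩ A').Finite := by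
        intro A hA A' hA'
        obtain ⟨s, t, -, hs, ht, rfl⟩ := hsub₁ A hA
        obtain ⟨s', t', -, hs', ht', rfl⟩ := hsub₂ A' hA'
        refine (finite_singleton (γ l)).subset ?_
        rintro _ ⟨⟨x, hx, rfl⟩, x', hx', h⟩
        have hxl := hx.2.trans ht
        have hux := hs'.trans hx'.1
        have hxx : x' = x := hinj (hsub ⟨hu.1.trans hux, hx'.2.trans ht'⟩)
          (hsub ⟨hs.trans hx.1, hxl.trans hl.2⟩) h
        rw [show x = l by linarith]
        exact mem_singleton _
      refine ⟨F₁ ∪ F₂, hF₁.union hF₂, ?_, ?_, ?_, fun Φ f hΦ h h' => ?_⟩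
      · rintro A (hA | hA)
        · obtain ⟨s, t, hst, hs, ht, rfl⟩ := hsub₁ A hA
          exact ⟨s, t, hst, hs, ht.trans hl.2, rfl⟩
        · obtain ⟨s, t, hst, hs, ht, rfl⟩ := hsub₂ A hA
          exact ⟨s, t, hst, hu.1.trans hs, ht, rfl⟩
      · rintro A (hA | hA) B' (rfl | hB')
        · obtain ⟨s, t, -, hs, ht, rfl⟩ := hsub₁ A hA
          refine (finite_singleton (γ l)).subset ?_
          rintro _ ⟨⟨x, hx, rfl⟩, hxB⟩
          have hxl := hx.2.trans ht
          rw [le_antisymm hxl (hlmin ⟨⟨hs.trans hx.1, hxl.trans hl.2⟩, hxB⟩)]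
          exact mem_singleton _
        · exact hfin₁ A hA B' hB'
        · obtain ⟨s, t, -, hs, ht, rfl⟩ := hsub₂ A hA
          refine (finite_singleton (γ u)).subset ?_
          rintro _ ⟨⟨x, hx, rfl⟩, hxB⟩
          have hux := hs.trans hx.1
          rw [le_antisymm (humax ⟨⟨hu.1.trans hux, hx.2.trans ht⟩, hxB⟩) hux]
          exact mem_singleton _
        · exact hfin₂ A hA B' hB'
      · rintro A (hA | hA) A' (hA' | hA') hne'
        · exact hpair₁ A hA A' hA' hne'
        · exact h12 A hA A' hA'
        · rw [inter_comm]
          exact h12 A' hA' A hA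
        · exact hpair₂ A hA A' hA' hne'
      · have e1 := hex₁ Φ f hΦ (hmono h) fun A hA => h' A (Or.inl hA)
        have e2 := hex₂ Φ f hΦ (hmono h) fun A hA => h' A (Or.inr hA)
        have e3 := h B (mem_insert B F) _ hlB _ huB
        have haI := hsub ⟨le_rfl, hab⟩
        have e4 := hΦ (γ a) (γ l) (γ u) (hsmall _ haI _ (hsub hl)) (hsmall _ haI _ (hsub hu))
        have e5 := hΦ (γ a) (γ u) (γ b) (hsmall _ haI _ (hsub hu))
          (hsmall _ haI _ (hsub ⟨hab, le_rfl⟩))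
        linarith

end

section
variable {M : Type*} [MetricSpace M] [MeasurableSpace M] [BorelSpace M]

theorem hausdorffMeasure_segment_le {γ : ℝ → M} {D : ℝ}
    (h : ∀ s ∈ Icc 0 D, ∀ t ∈ Icc 0 D, dist (γ s) (γ t) = |s - t|) :
    MeasureTheory.Measure.hausdorffMeasure 1 (γ '' Icc 0 D) ≤ ENNReal.ofReal D := by
  have hL : LipschitzOnWith 1 γ (Icc 0 D) := LipschitzOnWith.of_dist_le_mul fun s hs t ht => by
    rw [h s hs t ht, NNReal.coe_one, one_mul, Real.dist_eq]
  have h2 := hL.hausdorffMeasure_image_le (zero_le_one (α := ℝ))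
  rwa [ENNReal.coe_one, ENNReal.one_rpow, one_mul, MeasureTheory.hausdorffMeasure_real,
    Real.volume_Icc, sub_zero] at h2

/-- A finite system of short edges is realized, as far as cocycles are concerned, by a finite family
of arcs with finite pairwise intersections whose total length is at most that of the system. -/
theorem exists_arcs_of_edges {r : ℝ}
    (hseg : ∀ x y : M, ∃ γ : ℝ → M, γ 0 = x ∧ γ (dist x y) = y ∧
      ∀ s ∈ Icc 0 (dist x y), ∀ t ∈ Icc 0 (dist x y), dist (γ s) (γ t) = |s - t|)
    (E : Finset (M × M)) (hE : ∀ p ∈ E, dist p.1 p.2 < r) :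
    ∃ F : Set (Set M), F.Finite ∧ (∀ A ∈ F, IsArc A) ∧
      (∀ A ∈ F, ∀ B ∈ F, A ≠ B → (A ∩ B).Finite) ∧
      (∀ A ∈ F, ∀ p ∈ A, ∀ q ∈ A, dist p q < r) ∧
      MeasureTheory.Measure.hausdorffMeasure 1 (⋃₀ F) ≤ ∑ p ∈ E, ENNReal.ofReal (dist p.1 p.2) ∧
      ∀ Φ f, IsRipsCocycle r Φ → IsRipsPrimitive Φ f F →
        ∀ p ∈ E, Φ p.1 p.2 = f p.2 - f p.1 := by
  classical
  induction E using Finset.induction_on with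
  | empty => exact ⟨∅, finite_empty, by simp, by simp, by simp, by simp, by simp⟩
  | insert e E heE ih =>
    obtain ⟨F, hF, harc, hpair, hsmall, hlen, hex⟩ :=
      ih fun p hp => hE p (Finset.mem_insert_of_mem hp)
    obtain ⟨γ, h0, h1, hγ⟩ := hseg e.1 e.2
    have her := hE e (Finset.mem_insert_self e E)
    have hγc : ContinuousOn γ (Icc 0 (dist e.1 e.2)) :=
      (LipschitzOnWith.of_dist_le_mul (K := 1) fun s hs t ht => by
        rw [hγ s hs t ht, NNReal.coe_one, one_mul, Real.dist_eq]).continuousOn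
    have hγi : InjOn γ (Icc 0 (dist e.1 e.2)) := fun s hs t ht hst => by
      rw [← dist_eq_zero, hγ s hs t ht, abs_eq_zero, sub_eq_zero] at hst
      exact hst
    have hγs : ∀ s ∈ Icc 0 (dist e.1 e.2), ∀ t ∈ Icc 0 (dist e.1 e.2), dist (γ s) (γ t) < r := by
      intro s hs t ht
      rw [hγ s hs t ht]
      refine lt_of_le_of_lt ?_ her
      rw [abs_sub_le_iff]
      constructor <;> linarith [hs.1, hs.2, ht.1, ht.2]
    obtain ⟨F', hF', hsub, hfin, hpair', hex'⟩ := exists_subarcs hγc hγi hγs hF (fun B hB => by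
      obtain ⟨δ, a, b, -, hδ, -, rfl⟩ := harc B hB
      exact (isCompact_Icc.image_of_continuousOn hδ).isClosed) 0 (dist e.1 e.2) dist_nonneg
        le_rfl le_rfl
    refine ⟨F ∪ F', hF.union hF', ?_, ?_, ?_, ?_, ?_⟩
    · rintro A (hA | hA)
      · exact harc A hA
      · obtain ⟨s, t, hst, hs, ht, rfl⟩ := hsub A hA
        exact ⟨γ, s, t, hst, hγc.mono (Icc_subset_Icc hs ht), hγi.mono (Icc_subset_Icc hs ht), rfl⟩
    · rintro A (hA | hA) B (hB | hB) hne
      · exact hpair A hA B hB hne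
      · rw [inter_comm]
        exact hfin B hB A hA
      · exact hfin A hA B hB
      · exact hpair' A hA B hB hne
    · rintro A (hA | hA)
      · exact hsmall A hA
      · obtain ⟨s, t, -, hs, ht, rfl⟩ := hsub A hA
        rintro _ ⟨x, hx, rfl⟩ _ ⟨y, hy, rfl⟩
        exact hγs x (Icc_subset_Icc hs ht hx) y (Icc_subset_Icc hs ht hy)
    · rw [Finset.sum_insert heE, sUnion_union, union_comm]
      refine (MeasureTheory.measure_union_le _ _).trans (add_le_add ?_ hlen)
      refine (MeasureTheory.measure_mono (sUnion_subset fun A hA => ?_)).trans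
        (hausdorffMeasure_segment_le hγ)
      obtain ⟨s, t, -, hs, ht, rfl⟩ := hsub A hA
      exact image_mono (Icc_subset_Icc hs ht)
    · intro Φ f hΦ hf p hp
      have hfF : IsRipsPrimitive Φ f F := fun A hA => hf A (Or.inl hA)
      rcases Finset.mem_insert.1 hp with rfl | hp
      · have := hex' Φ f hΦ hfF fun A hA => hf A (Or.inr hA)
        rwa [h0, h1] at this
      · exact hex Φ f hΦ hfF p hp
end

/-! ### From singular cocycles to functions of two points -/

section
variable {M : Type u} [MetricSpace M]

/-- A choice of segments between any two points of a metric space. -/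
def IsSegmentSystem (seg : M → M → C(ℝ, M)) : Prop :=
  ∀ x y, seg x y 0 = x ∧ seg x y (dist x y) = y ∧ ∀ t, dist x (seg x y t) ≤ dist x y

theorem exists_isSegmentSystem
    (h : ∀ x y : M, ∃ γ : ℝ → M, γ 0 = x ∧ γ (dist x y) = y ∧
      ∀ s ∈ Icc 0 (dist x y), ∀ t ∈ Icc 0 (dist x y), dist (γ s) (γ t) = |s - t|) :
    ∃ seg : M → M → C(ℝ, M), IsSegmentSystem seg := by
  have key : ∀ x y : M, ∃ g : C(ℝ, M), g 0 = x ∧ g (dist x y) = y ∧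
      ∀ t, dist x (g t) ≤ dist x y := by
    intro x y
    obtain ⟨γ, h0, h1, hγ⟩ := h x y
    have hγc : ContinuousOn γ (Icc 0 (dist x y)) :=
      (LipschitzOnWith.of_dist_le_mul (K := 1) fun s hs t ht => by
        rw [hγ s hs t ht, NNReal.coe_one, one_mul, Real.dist_eq]).continuousOn
    refine ⟨⟨fun t => γ (projIcc 0 (dist x y) dist_nonneg t), hγc.comp_continuous
      (continuous_subtype_val.comp continuous_projIcc) fun t => (projIcc _ _ _ t).2⟩, ?_, ?_, ?_⟩
    · simpa using h0
    · simpa using h1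
    · intro t
      have hm := (projIcc 0 (dist x y) dist_nonneg t).2
      have := hγ 0 ⟨le_rfl, dist_nonneg⟩ _ hm
      rw [h0, zero_sub, abs_neg, abs_of_nonneg hm.1] at this
      exact this.le.trans hm.2
  choose seg hseg using key
  exact ⟨seg, hseg⟩

/-- The integrals of a singular cochain along a system of segments. -/
noncomputable def segmentCochain (seg : M → M → C(ℝ, M)) :
    (C(stdSimplex ℝ (Fin 2), M) → ℝ) →ₗ[ℝ] (M → M → ℝ) where
  toFun c x y := lineValue c (seg x y) 0 (dist x y)
  map_add' _ _ := rfl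
  map_smul' _ _ := rfl

/-- The space of real singular `1`-cocycles. -/
def singularCocycles (M : Type*) [TopologicalSpace M] :
    Submodule ℝ (C(stdSimplex ℝ (Fin 2), M) → ℝ) where
  carrier := {c | IsSingularCocycle c}
  zero_mem' _ := by simp
  add_mem' {a b} ha hb σ := by
    have h1 := ha σ
    have h2 := hb σ
    simp only [Pi.add_apply]
    linarith
  smul_mem' k a ha σ := by
    have h1 := ha σ
    simp only [Pi.smul_apply, smul_eq_mul]
    linear_combination k * h1

variable {seg : M → M → C(ℝ, M)} {r : ℝ} {c : C(stdSimplex ℝ (Fin 2), M) → ℝ}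

/-- The segment from `y` to `z` stays within `dist y z < 2 * r` of `y`, hence in the ball of radius
`3 * r` about `x`. -/
theorem IsPotentialOn.segmentCochain_eq (hseg : IsSegmentSystem seg) {x : M} {f : M → ℝ}
    (hf : IsPotentialOn c f (Metric.ball x (3 * r))) {y z : M} (hy : dist x y < r)
    (hz : dist x z < r) : segmentCochain seg c y z = f z - f y := by
  have h : ∀ t, seg y z t ∈ Metric.ball x (3 * r) := by
    intro t
    have h1 := (hseg y z).2.2 t
    have h2 := dist_triangle x y (seg y z t)
    have h3 := dist_triangle_left y z x
    rw [Metric.mem_ball, dist_comm]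
    linarith
  have := hf.lineValue_eq (seg y z) 0 (dist y z) fun t _ => h t
  rwa [(hseg y z).1, (hseg y z).2.1] at this

theorem isRipsCocycle_segmentCochain (hseg : IsSegmentSystem seg) (hr : 0 < r)
    (hpot : ∀ x, ∃ f, IsPotentialOn c f (Metric.ball x (3 * r))) :
    IsRipsCocycle r (segmentCochain seg c) := by
  intro x y z hy hz
  obtain ⟨f, hf⟩ := hpot x
  have hx : dist x x < r := by simpa
  rw [hf.segmentCochain_eq hseg hy hz, hf.segmentCochain_eq hseg hx hy,
    hf.segmentCochain_eq hseg hx hz]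
  ring

/-- A function on a finite union of closed sets that is a primitive on each of them is a potential
on the union. -/
theorem isPotentialOn_iUnion (hseg : IsSegmentSystem seg) (hr : 0 < r) (hc : IsSingularCocycle c)
    (hpot : ∀ x, ∃ f, IsPotentialOn c f (Metric.ball x (3 * r))) {ι : Type*} [Finite ι]
    {Q : ι → Set M} (hQ : ∀ i, IsClosed (Q i)) {f : M → ℝ}
    (hf : ∀ i, ∀ p ∈ Q i, ∀ q ∈ Q i, segmentCochain seg c p q = f q - f p) :
    IsPotentialOn c f (⋃ i, Q i) := by
  refine isPotentialOn_of_local hc fun x hx => ?_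
  obtain ⟨k, hk⟩ := hpot x
  -- Near `x` only the sets containing `x` occur, so `f` differs from the local potential `k` by a
  -- constant there.
  have hnear : ∀ᶠ y in 𝓝 x, (∀ i, y ∈ Q i → x ∈ Q i) ∧ y ∈ Metric.ball x r := by
    refine (eventually_all.2 fun i => ?_).and (Metric.ball_mem_nhds x hr)
    by_cases hxi : x ∈ Q i
    · exact Eventually.of_forall fun _ _ => hxi
    · filter_upwards [(hQ i).isOpen_compl.mem_nhds hxi] with y hy hy'
      exact absurd hy' hy
  refine ⟨_, hnear, fun σ hσ => ?_⟩
  have hval : ∀ t, f (σ t) - f x = k (σ t) - k x := by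
    intro t
    obtain ⟨⟨h1, h2⟩, h3⟩ := hσ t
    obtain ⟨i, hi⟩ := mem_iUnion.1 h3
    rw [← hf i x (h1 i hi) _ hi]
    exact hk.segmentCochain_eq hseg (by simpa) (by rwa [dist_comm])
  have h0 := hval (stdSimplex.vertex 0)
  have h1 := hval (stdSimplex.vertex 1)
  rw [hk σ fun t => Metric.ball_subset_ball (by linarith) (hσ t).1.2]
  linarith

theorem IsRipsTrivial.exists_isPotentialOn_univ (hseg : IsSegmentSystem seg) (hr : 0 < r)
    (hc : IsSingularCocycle c) (hpot : ∀ x, ∃ f, IsPotentialOn c f (Metric.ball x (3 * r)))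
    {s : ℝ} (hs : 0 < s) (h : IsRipsTrivial s (segmentCochain seg c)) :
    ∃ f, IsPotentialOn c f univ := by
  obtain ⟨f, hf⟩ := h
  refine ⟨f, isPotentialOn_of_local hc fun x _ => ?_⟩
  obtain ⟨k, hk⟩ := hpot x
  refine ⟨_, Metric.ball_mem_nhds x (lt_min hr hs), fun σ hσ => ?_⟩
  have hval : ∀ t, f (σ t) - f x = k (σ t) - k x := by
    intro t
    have h1 : dist x (σ t) < min r s := by rw [dist_comm]; exact (hσ t).1
    rw [← hf x _ (h1.trans_le (min_le_right _ _))]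
    exact hk.segmentCochain_eq hseg (by simpa) (h1.trans_le (min_le_left _ _))
  have h0 := hval (stdSimplex.vertex 0)
  have h1 := hval (stdSimplex.vertex 1)
  rw [hk σ fun t => Metric.ball_subset_ball
    ((min_le_left r s).trans (by linarith)) (hσ t).1]
  linarith

theorem IsPotentialOn.isRipsTrivial (hseg : IsSegmentSystem seg) {f : M → ℝ}
    (hf : IsPotentialOn c f univ) (s : ℝ) : IsRipsTrivial s (segmentCochain seg c) := by
  refine ⟨f, fun x y _ => ?_⟩
  have := hf.lineValue_eq (seg x y) 0 (dist x y) fun t _ => mem_univ _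
  rwa [(hseg x y).1, (hseg x y).2.1] at this

/-- A potential on a short arc is a primitive there. -/
theorem IsPotentialOn.segmentCochain_eq_of_isArc (hseg : IsSegmentSystem seg) (hr : 0 < r)
    (hpot : ∀ x, ∃ f, IsPotentialOn c f (Metric.ball x (3 * r))) {A : Set M} (hA : IsArc A)
    (hAr : ∀ p ∈ A, ∀ q ∈ A, dist p q < r) {f : M → ℝ} (hf : IsPotentialOn c f A) {p q : M}
    (hp : p ∈ A) (hq : q ∈ A) : segmentCochain seg c p q = f q - f p := by
  obtain ⟨γ, a, b, hab, hγ, -, rfl⟩ := hA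
  obtain ⟨s, hs, rfl⟩ := hp
  obtain ⟨t, ht, rfl⟩ := hq
  obtain ⟨k, hk⟩ := hpot (γ s)
  let g : C(ℝ, M) := ⟨fun t => γ (projIcc a b hab t), hγ.comp_continuous
    (continuous_subtype_val.comp continuous_projIcc) fun t => (projIcc _ _ _ t).2⟩
  have hgA : ∀ x, g x ∈ γ '' Icc a b := fun x => mem_image_of_mem _ (projIcc a b hab x).2
  have hgs : ∀ x ∈ Icc a b, g x = γ x := fun x hx =>
    congrArg (fun z : Icc a b => γ z) (projIcc_of_mem hab hx)
  -- Both `f` on the arc and `k` on the ball compute the value of `c` along the arc, so their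
  -- increments agree.
  have e1 := hf.lineValue_eq g s t fun x _ => hgA x
  have e2 := hk.lineValue_eq g s t fun x _ => by
    have := hAr _ (mem_image_of_mem _ hs) _ (hgA x)
    rw [Metric.mem_ball, dist_comm]
    linarith
  rw [hgs s hs, hgs t ht] at e1 e2
  rw [hk.segmentCochain_eq hseg (by simpa) (hAr _ (mem_image_of_mem _ hs) _ (mem_image_of_mem _ ht)),
    ← e2, e1]

/-- The marked points of a decomposition of a capturing graph into small pieces form a capturing
system of edges. -/
theorem capturesRips_of_pieces (hseg : IsSegmentSystem seg) (hr : 0 < r)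
    (hpot : ∀ c : C(stdSimplex ℝ (Fin 2), M) → ℝ, IsSingularCocycle c →
      ∀ x, ∃ f, IsPotentialOn c f (Metric.ball x (3 * r)))
    {ι : Type*} [Fintype ι] {Q : ι → Set M} {x y : ι → M} (hQc : ∀ i, IsCompact (Q i))
    (hx : ∀ i, x i ∈ Q i) (hQr : ∀ i, ∀ z ∈ Q i, ∀ w ∈ Q i, dist z w < r)
    (hQQ : ∀ i j, i ≠ j → Q i ∩ Q j ⊆ {x i, y i}) (hcap : CapturesTopology (⋃ i, Q i)) (s : ℝ)
    {E : Finset (M × M)} (hE : ∀ i, (x i, y i) ∈ E) :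
    CapturesRips ((singularCocycles M).map (segmentCochain seg)) s id E := by
  rintro _ ⟨c, hc, rfl⟩ ⟨f₀, hf₀⟩
  have hR := isRipsCocycle_segmentCochain hseg hr (hpot c hc)
  set Φ := segmentCochain seg c with hΦ
  have hend : ∀ i, ∀ w ∈ ({x i, y i} : Set M), f₀ (x i) + Φ (x i) w = f₀ w := by
    rintro i w (rfl | rfl)
    · rw [hR.self hr, add_zero]
    · have := hf₀ _ (hE i)
      simp only [id] at this
      linarith
  -- On the piece `Q i` the primitive is `f₀ (x i) + Φ (x i) w`. A point common to two pieces is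
  -- marked in both, and there both formulas give `f₀ w`.
  have hcons : ∀ i j w, w ∈ Q i → w ∈ Q j → f₀ (x i) + Φ (x i) w = f₀ (x j) + Φ (x j) w := by
    intro i j w hi hj
    by_cases hij : i = j
    · rw [hij]
    · rw [hend i w (hQQ i j hij ⟨hi, hj⟩), hend j w (hQQ j i (Ne.symm hij) ⟨hj, hi⟩)]
  have hex : ∀ w, ∃ v : ℝ, ∀ i, w ∈ Q i → v = f₀ (x i) + Φ (x i) w := by
    intro w
    by_cases h : ∃ i, w ∈ Q i
    · obtain ⟨i, hi⟩ := h
      exact ⟨_, fun j hj => hcons i j w hi hj⟩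
    · exact ⟨0, fun i hi => absurd ⟨i, hi⟩ h⟩
  choose f hf using hex
  have hpotΓ := isPotentialOn_iUnion (f := f) hseg hr hc (hpot c hc) (fun i => (hQc i).isClosed)
    (fun i p hp q hq => by
      rw [hf p i hp, hf q i hq, ← hΦ,
        hR (x i) p q (hQr i _ (hx i) _ hp) (hQr i _ (hx i) _ hq)]
      ring)
  obtain ⟨k, hk⟩ := (capturesTopology_iff _).1 hcap c hc ⟨f, hpotΓ⟩
  exact hk.isRipsTrivial hseg s

end

/-! ### Existence of a shortest graph -/

/-- In a compact metric space there is a shortest capturing system of short edges. -/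
theorem exists_minimal_capturesRips {M : Type u} [MetricSpace M] [CompactSpace M] [Nonempty M]
    {seg : M → M → C(ℝ, M)} {r : ℝ} (hseg : IsSegmentSystem seg) (hr : 0 < r)
    (hpot : ∀ c : C(stdSimplex ℝ (Fin 2), M) → ℝ, IsSingularCocycle c →
      ∀ x, ∃ f, IsPotentialOn c f (Metric.ball x (3 * r))) :
    ∃ E : Finset (M × M),
      CapturesRips ((singularCocycles M).map (segmentCochain seg)) (r / 16) id E ∧
      (∀ p ∈ E, dist p.1 p.2 ≤ r / 4) ∧ ∀ E' : Finset (M × M),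
        CapturesRips ((singularCocycles M).map (segmentCochain seg)) (r / 16) id E' →
        (∀ p ∈ E', dist p.1 p.2 ≤ r / 4) → edgeSum id E ≤ edgeSum id E' := by
  classical
  have hZ : ∀ Φ ∈ (singularCocycles M).map (segmentCochain seg), IsRipsCocycle r Φ := by
    rintro _ ⟨c, hc, rfl⟩
    exact isRipsCocycle_segmentCochain hseg hr (hpot c hc)
  have hδ : 0 < r / 16 := by positivity
  have hε : 0 < r / 4 := by positivity
  obtain ⟨N, hN⟩ : ∃ N : Finset M, ∀ y, ∃ p ∈ N, dist p y < r / 16 := by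
    obtain ⟨t, -, ht, hcov⟩ := (isCompact_univ (X := M)).finite_cover_balls hδ
    refine ⟨ht.toFinset, fun y => ?_⟩
    obtain ⟨p, hp, hy⟩ := mem_iUnion₂.1 (hcov (mem_univ y))
    exact ⟨p, ht.mem_toFinset.2 hp, by rw [dist_comm]; exact hy⟩
  -- With net radius `r / 16`, points at distance below `r / 16` have net points less than `3 * r /
  -- 16` apart, so the net pairs up to `r / 4` suffice.
  have hE₀ : CapturesRips ((singularCocycles M).map (segmentCochain seg)) (r / 16) id
      ((N ×ˢ N).filter fun p => dist p.1 p.2 ≤ r / 4) := by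
    rintro Φ hΦ ⟨f, hf⟩
    refine (hZ Φ hΦ).trivial_of_net hδ hδ (N := N) (k := f) (by linarith) hN fun p hp q hq hpq => ?_
    exact hf (p, q) (Finset.mem_filter.2 ⟨Finset.mem_product.2 ⟨hp, hq⟩, by
      simp only
      linarith⟩)
  exact hE₀.exists_minimal hZ hδ hε (by linarith) hN fun p hp => (Finset.mem_filter.1 hp).2

theorem graphLength_sUnion_insert_singleton {M : Type u} [EMetricSpace M] [MeasurableSpace M]
    [BorelSpace M] (x : M) (F : Set (Set M)) :
    graphLength (⋃₀ insert {x} F) ≤ graphLength (⋃₀ F) := by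
  have := MeasureTheory.Measure.nullSingletonClass_hausdorff M (zero_lt_one (α := ℝ))
  rw [sUnion_insert, graphLength]
  refine (MeasureTheory.measure_union_le _ _).trans ?_
  rw [MeasureTheory.measure_singleton, zero_add]
  rfl

section
variable {M : Type u} [MetricSpace M] [MeasurableSpace M] [BorelSpace M]
  {seg : M → M → C(ℝ, M)} {r : ℝ}

/-- A capturing system of short edges is realized by a capturing graph which is not longer. -/
theorem exists_graph_of_capturesRips [Nonempty M]
    (hmid : ∀ x y : M, ∃ γ : ℝ → M, γ 0 = x ∧ γ (dist x y) = y ∧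
      ∀ s ∈ Icc 0 (dist x y), ∀ t ∈ Icc 0 (dist x y), dist (γ s) (γ t) = |s - t|)
    (hseg : IsSegmentSystem seg) (hr : 0 < r)
    (hpot : ∀ c : C(stdSimplex ℝ (Fin 2), M) → ℝ, IsSingularCocycle c →
      ∀ x, ∃ f, IsPotentialOn c f (Metric.ball x (3 * r)))
    {s : ℝ} (hs : 0 < s) {E : Finset (M × M)} (hEr : ∀ p ∈ E, dist p.1 p.2 < r)
    (hE : CapturesRips ((singularCocycles M).map (segmentCochain seg)) s id E) :
    ∃ Γ : Set M, IsGraphIn Γ ∧ CapturesTopology Γ ∧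
      graphLength Γ ≤ ENNReal.ofReal (edgeSum id E) := by
  obtain ⟨F, hF, harc, hpair, hsmall, hlen, hex⟩ := exists_arcs_of_edges hmid E hEr
  -- The edge system may be empty, whereas a graph may not; an extra point of measure zero is added.
  obtain ⟨pt⟩ := ‹Nonempty M›
  refine ⟨⋃₀ insert {pt} F, ?_, ?_, ?_⟩
  · refine isGraphIn_sUnion_of_isArc (hF.insert _) (insert_nonempty _ _) ?_ ?_
    · rintro A (rfl | hA)
      · exact ⟨fun _ => pt, 0, 0, le_rfl, continuousOn_const, by simp, by simp⟩
      · exact harc A hA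
    · rintro A (rfl | hA) B (rfl | hB) hne
      · exact absurd rfl hne
      · exact (finite_singleton _).inter_of_left _
      · exact (finite_singleton _).inter_of_right _
      · exact hpair A hA B hB hne
  · rw [capturesTopology_iff]
    rintro c hc ⟨f, hf⟩
    refine (hE _ (Submodule.mem_map_of_mem hc) ⟨f, ?_⟩).exists_isPotentialOn_univ hseg hr hc
      (hpot c hc) hs
    refine hex _ f (isRipsCocycle_segmentCochain hseg hr (hpot c hc)) fun A hA p hp q hq => ?_
    refine IsPotentialOn.segmentCochain_eq_of_isArc hseg hr (hpot c hc) (harc A hA)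
      (hsmall A hA) (fun σ hσ => hf σ fun t => ?_) hp hq
    exact mem_sUnion_of_mem (hσ t) (mem_insert_of_mem _ hA)
  · rw [edgeSum, ENNReal.ofReal_sum_of_nonneg fun _ _ => dist_nonneg]
    exact (graphLength_sUnion_insert_singleton pt F).trans hlen

/-- A capturing graph yields a capturing system of short edges which is not longer. -/
theorem exists_capturesRips_of_graph (hseg : IsSegmentSystem seg) (hr : 0 < r)
    (hpot : ∀ c : C(stdSimplex ℝ (Fin 2), M) → ℝ, IsSingularCocycle c →
      ∀ x, ∃ f, IsPotentialOn c f (Metric.ball x (3 * r)))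
    {ε : ℝ} (hε : 0 < ε) (hεr : ε < r) (s : ℝ) {Γ : Set M} (hΓ : IsGraphIn Γ)
    (hcap : CapturesTopology Γ) :
    ∃ E : Finset (M × M), CapturesRips ((singularCocycles M).map (segmentCochain seg)) s id E ∧
      (∀ p ∈ E, dist p.1 p.2 ≤ ε) ∧ ENNReal.ofReal (edgeSum id E) ≤ graphLength Γ := by
  classical
  obtain ⟨ι, hι, Q, x, y, hQc, hQ, hx, hy, hQε, hQQ, rfl⟩ := hΓ.exists_pieces hε
  have := Fintype.ofFinite ι
  refine ⟨Finset.univ.image fun i => (x i, y i), capturesRips_of_pieces hseg hr hpot hQc hx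
    (fun i z hz w hw => (hQε i z hz w hw).trans_lt hεr) hQQ hcap s
    (fun i => Finset.mem_image_of_mem _ (Finset.mem_univ i)), fun p hp => ?_, ?_⟩
  · obtain ⟨i, -, rfl⟩ := Finset.mem_image.1 hp
    exact hQε i _ (hx i) _ (hy i)
  · have hsum : edgeSum id (Finset.univ.image fun i => (x i, y i)) ≤ ∑ i, dist (x i) (y i) :=
      Finset.sum_image_le_of_nonneg (f := fun q : M × M => dist q.1 q.2) fun _ _ => dist_nonneg
    refine (ENNReal.ofReal_le_ofReal hsum).trans ?_
    rw [ENNReal.ofReal_sum_of_nonneg fun _ _ => dist_nonneg]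
    exact sum_ofReal_dist_le_hausdorffMeasure hQc hQ hx hy hQQ

/-- On a compact metric space with midpoints in which short loops are homologically trivial, there
is a shortest graph capturing the topology. -/
theorem exists_shortest_graph [CompactSpace M] [Nonempty M]
    (hmid : ∀ x y : M, ∃ m, dist x m = dist x y / 2 ∧ dist m y = dist x y / 2)
    {r₀ : ℝ} (hr₀ : 0 < r₀) (hpot₀ : ∀ c : C(stdSimplex ℝ (Fin 2), M) → ℝ, IsSingularCocycle c →
      ∀ x, ∃ f, IsPotentialOn c f (Metric.ball x r₀)) :
    ∃ Γ : Set M, IsGraphIn Γ ∧ CapturesTopology Γ ∧ graphLength Γ < ⊤ ∧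
      ∀ Γ' : Set M, IsGraphIn Γ' → CapturesTopology Γ' → graphLength Γ ≤ graphLength Γ' := by
  obtain ⟨r, hr, hpot⟩ : ∃ r > 0, ∀ c : C(stdSimplex ℝ (Fin 2), M) → ℝ, IsSingularCocycle c →
      ∀ x, ∃ f, IsPotentialOn c f (Metric.ball x (3 * r)) :=
    ⟨r₀ / 3, by positivity, by rwa [mul_div_cancel₀ r₀ three_ne_zero]⟩
  obtain ⟨seg, hseg⟩ := exists_isSegmentSystem (exists_segment hmid)
  obtain ⟨E, hE, hEr, hmin⟩ := exists_minimal_capturesRips hseg hr hpot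
  obtain ⟨Γ, hΓ, hcap, hlen⟩ := exists_graph_of_capturesRips (exists_segment hmid) hseg hr hpot
    (by positivity) (fun p hp => (hEr p hp).trans_lt (by linarith)) hE
  refine ⟨Γ, hΓ, hcap, hlen.trans_lt ENNReal.ofReal_lt_top, fun Γ' hΓ' hcap' => ?_⟩
  obtain ⟨E', hE', hEr', hlen'⟩ := exists_capturesRips_of_graph hseg hr hpot
    (show 0 < r / 4 by positivity) (by linarith) (r / 16) hΓ' hcap'
  exact hlen.trans ((ENNReal.ofReal_le_ofReal (hmin E' hE' hEr')).trans hlen')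

end

theorem mainTheorem8
    (M : Type u) [EMetricSpace M] [MeasurableSpace M] [BorelSpace M]
    [CompactSpace M] [ConnectedSpace M]
    [ChartedSpace (EuclideanSpace ℝ (Fin 2)) M] [IsManifold (𝓡 2) ∞ M]
    [Bundle.RiemannianBundle (fun x : M => TangentSpace (𝓡 2) x)]
    [IsContMDiffRiemannianBundle (𝓡 2) ∞ (EuclideanSpace ℝ (Fin 2))
      (fun x : M => TangentSpace (𝓡 2) x)]
    [IsRiemannianManifold (𝓡 2) M]
    (hM : OrientableSurface M) :
    ∃ Γ : Set M, IsGraphIn Γ ∧ CapturesTopology Γ ∧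
      graphLength Γ = minGraphLength M ∧ minGraphLength M < ⊤ := by
  have hfin : ∀ x y : M, edist x y ≠ ⊤ := edist_ne_top_of_preconnected
  have happrox : ∀ x y : M, ∀ ε : ℝ≥0∞, ε ≠ 0 →
      ∃ m : M, edist x m = edist x y / 2 ∧ edist m y ≤ edist x y / 2 + ε := fun x y ε hε =>
    exists_approx_midpoint (I := 𝓡 2) x y (hfin x y) hε
  suffices h : ∃ Γ : Set M, IsGraphIn Γ ∧ CapturesTopology Γ ∧ graphLength Γ < ⊤ ∧
      ∀ Γ' : Set M, IsGraphIn Γ' → CapturesTopology Γ' → graphLength Γ ≤ graphLength Γ' by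
    obtain ⟨Γ, hΓ, hcap, hlt, hmin⟩ := h
    have heq : graphLength Γ = minGraphLength M :=
      le_antisymm (le_iInf₂ fun Γ' h => hmin Γ' h.1 h.2) (iInf₂_le Γ ⟨hΓ, hcap⟩)
    exact ⟨Γ, hΓ, hcap, heq, heq ▸ hlt⟩
  -- This keeps the extended distance and the topology, so graphs and their lengths are unchanged.
  let _ : MetricSpace M := EMetricSpace.toMetricSpace hfin
  have hmid := exists_midpoint_of_approx (M := M) fun x y ε hε => by
    obtain ⟨m, h1, h2⟩ := happrox x y (ENNReal.ofReal ε) (by simpa using hε)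
    refine ⟨m, ?_, ?_⟩
    · have h1' := congrArg ENNReal.toReal h1
      rw [ENNReal.toReal_div] at h1'
      change dist x m = dist x y / 2 at h1'
      linarith
    · have hd : edist x y / 2 ≠ ⊤ := ENNReal.div_ne_top (hfin x y) two_ne_zero
      have h2' := ENNReal.toReal_mono (ENNReal.add_ne_top.2 ⟨hd, ENNReal.ofReal_ne_top⟩) h2
      rw [ENNReal.toReal_add hd ENNReal.ofReal_ne_top, ENNReal.toReal_div,
        ENNReal.toReal_ofReal hε.le] at h2'
      exact h2'
  obtain ⟨r₀, hr₀, hpot₀⟩ := exists_radius_forall_isPotentialOn M (EuclideanSpace ℝ (Fin 2))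
  exact exists_shortest_graph hmid hr₀ hpot₀
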